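/- Let $d\ge 0$ and let $A=(a_1,\dots,a_n)$ be points of $\mathbb{R}^d$ that affinely span $\mathbb{R}^d$ (repeated points and affine dependencies are allowed). Let $v_i=(a_i,1)\in\mathbb{R}^{d+1}$, $V=(v_1,\dots,v_n)$, and let $Z(V)=\sum_{i=1}^n[0,v_i]$ be the zonotope of $V$. For disjoint $I,B\subseteq[n]$ put $\Pi_{I,B}=\sum_{i\in I}v_i+\sum_{b\in B}[0,v_b]$, and put $\Delta_B=\operatorname{conv}\{a_b:b\in B\}$. The faces of $\Pi_{I,B}$ are the $\Pi_{J,C}$ with $C\subseteq B$, $I\subseteq J\subseteq I\sqcup(B\setminus C)$. A *fine zonotopal tiling* $\mathcal P$ of $Z(V)$ is a collection of tiles $\Pi_{I,B}$, labelled by pairs $(I,B)$ of disjoint sets with $|B|=d+1$ and $(a_b)_{b\in B}$ affinely independent, that cover exactly $Z(V)$ and any two of which have empty intersection or intersect in a common (labelled) face. The order of $\Pi_{I,B}$ is $|I|$; write $\mathcal P^{(k)}$ for the set of tiles of order $k$. A *triangulation* of a region $R\subseteq\mathbb{R}^d$ is a collection of simplices $\Delta_B$ (given by their index sets $B$, with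 $|B|=d+1$ and $(a_b)_{b\in B}$ affinely independent) whose union is $R$ and with $\Delta_B\cap\Delta_{B'}=\Delta_{B\cap B'}$ for any two of them. For $Q\subseteq[n]$ and $r\ge 0$ let $E^{(r)}(Q)$ be the union of the $\Delta_B$ over all $\Pi_{I,B}\in\mathcal P^{(r)}$ with $I\subseteq Q$, $B\cap Q=\varnothing$. The *link region* of $Q$ is $\mathcal R(Q)=E^{(|Q|)}(Q)$. **Theorem.** For every fine zonotopal tiling $\mathcal P$ of $Z(V)$ there is a choice of triangulations $\mathcal T_I$ of the link regions $\mathcal R(I)$, one for each $I\subseteq[n]$ such that $\Pi_{I,B}\in\mathcal P$ for some $B$, such that $\mathcal P$ is constructed as follows. 1. $\mathcal I^{(0)}=\{\varnothing\}$. 2. For $0\le k\le n-d-1$ and every $I\in\mathcal I^{(k)}$, the region $\mathcal R(I)$ can be computed from the tiles of order less than $k$ that have already been constructed, as $$\mathcal R(I)=\operatorname{conv}\{a_i:i\notin I\}\setminus\bigcup_{r<k}E^{(r)}(I),$$ where the difference is one of $d$-dimensional regions (the closure of the interior of the set difference); it is triangulated by $\mathcal T_I$, and $$\mathcal P^{(k)}=\{\Pi_{I,B}: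 I\in\mathcal I^{(k)},\ \Delta_B\in\mathcal T_I\}.$$ 3. $\mathcal I^{(k+1)}=\{I\sqcup\{b\}:\Pi_{I,B}\in\mathcal P^{(k)},\ b\in B,\ \mathcal R(I\sqcup\{b\})\ne\varnothing\}$, where $\mathcal R(I\sqcup\{b\})$ is computed from the tiles constructed so far by the formula of step 2. 4. After the step $k=n-d-1$ one has $\mathcal I^{(n-d)}=\varnothing$, the process stops, and $\mathcal P=\bigsqcup_{k=0}^{n-d-1}\mathcal P^{(k)}$. In particular, for every $0\le k\le n-d-1$ the construction gives the spline space of order $k$ associated to $\mathcal P$, i.e. the span of the multivariate (simplex) splines of degree $k$ with knots $(a_i)_{i\in I\sqcup B}$, $\Pi_{I,B}\in\mathcal P^{(k)}$. -/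

import Mathlib

noncomputable section

namespace ZonotopalTiling

/-- Points of `ℝ^d`. -/
abbrev Pt (d : ℕ) : Type := EuclideanSpace ℝ (Fin d)

variable {d n : ℕ}

/-- The projective lift `v_i = (a_i, 1)` of a point, in `ℝ^d × ℝ = ℝ^(d+1)`. -/
def lift (a : Fin n → Pt d) (i : Fin n) : Pt d × ℝ := (a i, 1)

/-- The zonotope `Z(V)`, i.e. the Minkowski sum of the segments `[0, v_i]`. -/
def zonotope (a : Fin n → Pt d) : Set (Pt d × ℝ) :=
  {p | ∃ c : Fin n → ℝ, (∀ i, 0 ≤ c i ∧ c i ≤ 1) ∧ p = ∑ i, c i • lift a i}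

/-- A label `(I, B)`; it stands for the parallelepiped `Π_{I,B}`. -/
abbrev Label (n : ℕ) : Type := Finset (Fin n) × Finset (Fin n)

/-- The parallelepiped `Π_{I,B} = ∑_{i ∈ I} v_i + ∑_{b ∈ B} [0, v_b]`. -/
def cell (a : Fin n → Pt d) (t : Label n) : Set (Pt d × ℝ) :=
  {p | ∃ c : Fin n → ℝ, (∀ b ∈ t.2, 0 ≤ c b ∧ c b ≤ 1) ∧
    p = ∑ i ∈ t.1, lift a i + ∑ b ∈ t.2, c b • lift a b}

/-- `B` indexes `d + 1` affinely independent points. -/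
def IsSimplexIndex (a : Fin n → Pt d) (B : Finset (Fin n)) : Prop :=
  B.card = d + 1 ∧ AffineIndependent ℝ (fun b : B => a b)

/-- `Π_{J,C}` is the face of `Π_{I,B}` obtained by setting the coefficients with index in
`B \ C` equal to `1` (those with index in `J \ I`) or `0` (the others). -/
def IsFace (f t : Label n) : Prop :=
  f.2 ⊆ t.2 ∧ Disjoint f.1 f.2 ∧ t.1 ⊆ f.1 ∧ f.1 ⊆ t.1 ∪ t.2

/-- Fine zonotopal tilings of `Z(V)`: collections of full-dimensional parallelepipeds `Π_{I,B}`
that cover `Z(V)` and any two of which meet in a common face (possibly empty). Tiles and faces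
are labelled by their index sets, which matters when points are repeated or when distinct index
sets have the same sum of vectors. -/
structure IsFineTiling (a : Fin n → Pt d) (P : Set (Label n)) : Prop where
  disjoint : ∀ t ∈ P, Disjoint t.1 t.2
  nondegenerate : ∀ t ∈ P, IsSimplexIndex a t.2
  cover : ⋃ t ∈ P, cell a t = zonotope a
  inter : ∀ t ∈ P, ∀ t' ∈ P, cell a t ∩ cell a t' = ∅ ∨
    ∃ f : Label n, IsFace f t ∧ IsFace f t' ∧ cell a t ∩ cell a t' = cell a f

/-- The tiles of order `k`. -/
def ofOrder (P : Set (Label n)) (k : ℕ) : Set (Label n) := {t ∈ P | t.1.card = k}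

/-- The convex hull `Δ_B` of the points with index in `B`. -/
def simplex (a : Fin n → Pt d) (B : Finset (Fin n)) : Set (Pt d) :=
  convexHull ℝ (a '' (B : Set (Fin n)))

/-- The convex hull `ch_Q(A)` of the points with index outside `Q`. -/
def hullOutside (a : Fin n → Pt d) (Q : Finset (Fin n)) : Set (Pt d) :=
  convexHull ℝ (a '' {i | i ∉ Q})

/-- The region `E^(r)(Q)` determined by the tiles in `S`. -/
def region (a : Fin n → Pt d) (S : Set (Label n)) (r : ℕ) (Q : Finset (Fin n)) : Set (Pt d) :=
  ⋃ t ∈ {t ∈ ofOrder S r | Disjoint t.2 Q ∧ t.1 ⊆ Q}, simplex a t.2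

/-- The link region `R(Q) = E^(k)(Q)`, `k = |Q|`, of a tiling. -/
def linkRegion (a : Fin n → Pt d) (P : Set (Label n)) (Q : Finset (Fin n)) : Set (Pt d) :=
  region a P Q.card Q

/-- The link region of `Q` computed from the tiles of order less than `k = |Q|`: the difference
of `ch_Q(A)` and the union of the `E^(r)(Q)`, `r < k`, as a difference of `d`-dimensional regions,
i.e. as the closure of the interior of the set difference. -/
def computedRegion (a : Fin n → Pt d) (S : Set (Label n)) (Q : Finset (Fin n)) : Set (Pt d) :=
  closure (interior (hullOutside a Q \ ⋃ r ∈ Finset.range Q.card, region a S r Q))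

/-- A triangulation of the region `R` with vertices among the `a_i`: a collection of
nondegenerate simplices `Δ_B`, given by their index sets `B`, that cover `R` exactly and any two
of which meet in their common face. -/
structure IsTriangulation (a : Fin n → Pt d) (T : Set (Finset (Fin n))) (R : Set (Pt d)) :
    Prop where
  nondegenerate : ∀ B ∈ T, IsSimplexIndex a B
  cover : ⋃ B ∈ T, simplex a B = R
  inter : ∀ B ∈ T, ∀ B' ∈ T, simplex a B ∩ simplex a B' = simplex a (B ∩ B')

/-- The tiles `Π_{I,B}` with `I` in a given family of index sets and `Δ_B` in the chosen
triangulation `T I`. -/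
def newTiles (T : Finset (Fin n) → Set (Finset (Fin n))) (J : Set (Finset (Fin n))) :
    Set (Label n) := {t | t.1 ∈ J ∧ t.2 ∈ T t.1}

/-- The state of the construction before stage `k`: the family of index sets `𝓘^(k)` and the
set of all tiles found at the stages before `k`. It depends on the points and on the chosen
triangulations `T` only. -/
def state (a : Fin n → Pt d) (T : Finset (Fin n) → Set (Finset (Fin n))) :
    ℕ → Set (Finset (Fin n)) × Set (Label n)
  | 0 => ({∅}, ∅)
  | k + 1 =>
    let s := state a T k
    let found := s.2 ∪ newTiles T s.1
    ({Q | ∃ t ∈ newTiles T s.1, ∃ b ∈ t.2, Q = insert b t.1 ∧ (computedRegion a found Q).Nonempty},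
      found)

/-- The family of index sets `𝓘^(k)` of the construction. -/
def indexSets (a : Fin n → Pt d) (T : Finset (Fin n) → Set (Finset (Fin n))) (k : ℕ) :
    Set (Finset (Fin n)) := (state a T k).1

/-- All tiles constructed at the stages before `k`. -/
def tilesBefore (a : Fin n → Pt d) (T : Finset (Fin n) → Set (Finset (Fin n))) (k : ℕ) :
    Set (Label n) := (state a T k).2

/-- The tiles constructed at stage `k`: `Π_{I,B}` with `I ∈ 𝓘^(k)` and `Δ_B ∈ T I`. -/
def tilesAt (a : Fin n → Pt d) (T : Finset (Fin n) → Set (Finset (Fin n))) (k : ℕ) :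
    Set (Label n) := newTiles T (indexSets a T k)

/-- The determinant with rows `(a_b, 1)`, `b ∈ B`, in increasing order of `b` (`0` unless
`|B| = d + 1`). -/
def rowDet (a : Fin n → Pt d) (B : Finset (Fin n)) : ℝ :=
  if h : B.card = d + 1 then
    (Matrix.of fun i j : Fin (d + 1) =>
      (Fin.snoc (fun c : Fin d => a (B.orderEmbOfFin h i) c) (1 : ℝ) : Fin (d + 1) → ℝ) j).det
  else 0

/-- `β` selects, from every index set `X` whose points affinely span `ℝ^d`, `d + 1` indices of
affinely independent points. -/
def IsSelection (a : Fin n → Pt d) (β : Finset (Fin n) → Finset (Fin n)) : Prop :=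
  ∀ X, (∃ B ⊆ X, IsSimplexIndex a B) → β X ⊆ X ∧ IsSimplexIndex a (β X)

open Classical in
/-- The normalized multivariate (simplex) spline of degree `k` with knots `a_i`, `i ∈ X`,
`|X| = k + d + 1`, by the usual recurrence, in which the subset `B` of `X` is given by `β`. It is
zero if the knots do not affinely span `ℝ^d`. -/
def spline (a : Fin n → Pt d) (β : Finset (Fin n) → Finset (Fin n)) :
    ℕ → Finset (Fin n) → Pt d → ℝ
  | 0, X, x => if x ∈ simplex a X then (d.factorial : ℝ) / |rowDet a X| else 0
  | k + 1, X, x =>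
    if β X ⊆ X ∧ IsSimplexIndex a (β X) then
      (((k + 1 : ℕ) + d : ℝ) / (k + 1 : ℕ)) * ∑ b ∈ β X,
        rowDet (Function.update a b x) (β X) / rowDet a (β X) * spline a β k (X.erase b) x
    else 0

/-- The space spanned by the splines of degree `k` associated to a collection of tiles of
order `k`. -/
def splineSpace (a : Fin n → Pt d) (β : Finset (Fin n) → Finset (Fin n)) (k : ℕ)
    (S : Set (Label n)) : Submodule ℝ (Pt d → ℝ) :=
  Submodule.span ℝ ((fun t : Label n => spline a β k (t.1 ∪ t.2)) '' S)

end ZonotopalTiling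

end

/-!
The tiling is the image of a section `σ` of the projection of the cube `[0, 1]^n` onto the zonotope,
with values in a union of faces of the cube. Along the direction `v_q` the coordinate `q` of `σ`
grows at a rate between `0` and `1`, and while the rate is `1` all other coordinates are constant.
By the fixed point theorem in dimension one, setting the coordinate `q` to `0` therefore turns `σ`
into a section over the zonotope of the remaining vectors. Iterating over `q ∈ Q` and intersecting
with a horizontal hyperplane near the origin, one finds that the tiles `Π_{I,B}` with `I ⊆ Q` and
`B ∩ Q = ∅` have simplices that cover `conv {a_i : i ∉ Q}` up to lower-dimensional simplices, and
that an interior point of one of these simplices `Δ_B` determines `I`. This is the formula for the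
link regions.

Every bottom vertex `Q ≠ ∅` arises from a tile of the previous order: the segment from a generic
point of a tile `Π_{Q,B}` to the origin leaves the tiles with bottom vertex `Q` through the relative
interior of a facet, and the tile on its other side has bottom vertex `Q \ {b}` for some `b ∈ Q`.
-/

noncomputable section

namespace ZonotopalTiling

theorem rel_of_finite_closed_cover {ι α : Type*} [ConditionallyCompleteLinearOrder α]
    [DenselyOrdered α] [TopologicalSpace α] [OrderTopology α] {R : α → α → Prop}
    (htrans : ∀ {r s t}, R r s → R s t → R r t) {S : ι → Set α} (hS : ∀ i, IsClosed (S i))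
    (F : Finset ι) {u v : α} (huv : u ≤ v) (hcover : Set.Icc u v ⊆ ⋃ i ∈ F, S i)
    (hR : ∀ i ∈ F, ∀ r ∈ S i, ∀ s ∈ S i, u ≤ r → r ≤ s → s ≤ v → R r s) : R u v := by
  classical
  induction F using Finset.strongInduction generalizing u with
  | H F ih =>
    obtain ⟨i, hi, hui⟩ := Set.mem_iUnion₂.1 (hcover ⟨le_rfl, huv⟩)
    obtain ⟨m, ⟨hm, hum, hmv⟩, hmax⟩ :=
      (isCompact_Icc.inter_left (hS i)).exists_isGreatest ⟨u, hui, le_rfl, huv⟩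
    have hRum : R u m := hR i hi u hui m hm le_rfl hum hmv
    rcases hmv.eq_or_lt with rfl | hlt
    · exact hRum
    have hIoc : Set.Ioc m v ⊆ ⋃ j ∈ F.erase i, S j := by
      intro r hr
      obtain ⟨j, hj, hrj⟩ := Set.mem_iUnion₂.1 (hcover ⟨hum.trans hr.1.le, hr.2⟩)
      have hji : j ≠ i := by
        rintro rfl
        exact (hmax ⟨hrj, hum.trans hr.1.le, hr.2⟩).not_gt hr.1
      exact Set.mem_biUnion (Finset.mem_coe.2 (Finset.mem_erase.2 ⟨hji, hj⟩)) hrj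
    have hIcc : Set.Icc m v ⊆ ⋃ j ∈ F.erase i, S j := by
      rw [← closure_Ioc hlt.ne]
      exact closure_minimal hIoc (isClosed_biUnion_finset fun j _ => hS j)
    exact htrans hRum (ih _ (Finset.erase_ssubset hi) hmv hIcc fun j hj r hr s hs hmr =>
      hR j (Finset.mem_of_mem_erase hj) r hr s hs (hum.trans hmr))

theorem interior_biUnion_eq_empty {ι X : Type*} [TopologicalSpace X] {s : Set ι} (hs : s.Finite)
    {f : ι → Set X} (hclosed : ∀ i ∈ s, IsClosed (f i)) (hempty : ∀ i ∈ s, interior (f i) = ∅) :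
    interior (⋃ i ∈ s, f i) = ∅ := by
  induction s, hs using Set.Finite.induction_on with
  | empty => simp
  | @insert i s _ _ ih =>
    rw [Set.forall_mem_insert] at hclosed hempty
    rw [Set.biUnion_insert, interior_union_isClosed_of_interior_empty hclosed.1
      (ih hclosed.2 hempty.2), hempty.1]

theorem exists_mem_forall_notMem_submodule {E : Type*} [AddCommGroup E] [Module ℝ E]
    [TopologicalSpace E] [IsTopologicalAddGroup E] [ContinuousSMul ℝ E] [T2Space E]
    [FiniteDimensional ℝ E] {U : Set E} (hU : IsOpen U) (hne : U.Nonempty)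
    {𝒲 : Set (Submodule ℝ E)} (hfin : 𝒲.Finite) (hproper : ∀ W ∈ 𝒲, W ≠ ⊤) :
    ∃ x ∈ U, ∀ W ∈ 𝒲, x ∉ W := by
  by_contra! hcover
  have hempty : interior (⋃ W ∈ 𝒲, (W : Set E)) = ∅ :=
    interior_biUnion_eq_empty hfin (fun W _ => W.closed_of_finiteDimensional) fun W hW =>
      Set.not_nonempty_iff_eq_empty.1 fun h => hproper W hW (W.eq_top_of_nonempty_interior' h)
  refine hne.ne_empty (Set.subset_empty_iff.1 (hempty ▸ interior_maximal (fun x hx => ?_) hU))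
  obtain ⟨W, hW, hxW⟩ := hcover x hx
  exact Set.mem_biUnion hW hxW

theorem add_smul_mem_of_convex {E : Type*} [AddCommGroup E] [Module ℝ E] {C : Set E}
    (hC : Convex ℝ C) {z w : E} {r s : ℝ} (hz : z ∈ C) (hzw : z + s • w ∈ C)
    (hr : r ∈ Set.Icc 0 s) : z + r • w ∈ C := by
  have hs : 0 ≤ s := hr.1.trans hr.2
  have hrs : r / s * s = r := div_mul_cancel_of_imp fun h0 => le_antisymm (h0 ▸ hr.2) hr.1
  have hmem := hC.add_smul_mem hz hzw ⟨div_nonneg hr.1 hs, div_le_one_of_le₀ hr.2 hs⟩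
  rwa [smul_smul, hrs] at hmem

theorem span_insert_image_ne_top {ι K M : Type*} [DivisionRing K] [AddCommGroup M] [Module K M]
    {v : ι → M} {w : M} {C : Finset ι} (hC : C.card + 1 < Module.finrank K M) :
    Submodule.span K (insert w (v '' C)) ≠ ⊤ := by
  classical
  intro htop
  have hle := finrank_span_finset_le_card (R := K) (insert w (C.image v))
  rw [Finset.coe_insert, Finset.coe_image, Set.finrank, htop, finrank_top] at hle
  exact (hle.trans ((Finset.card_insert_le _ _).trans
    (Nat.add_le_add_right Finset.card_image_le 1))).not_gt hC

section Cube

variable {ι : Type*} [DecidableEq ι]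

/-- The face of the cube `[0, 1]^ι` on which the coordinates in `I` are `1` and those outside
`I ∪ B` are `0`, for a label `(I, B)`. -/
def cubeFace (t : Finset ι × Finset ι) : Set (ι → ℝ) :=
  Set.Icc (t.1.piecewise 1 0) ((t.1 ∪ t.2).piecewise 1 0)

theorem mem_cubeFace {t : Finset ι × Finset ι} {x : ι → ℝ} :
    x ∈ cubeFace t ↔
      ∀ i, (0 ≤ x i ∧ x i ≤ 1) ∧ (i ∈ t.1 → x i = 1) ∧ (i ∉ t.1 → i ∉ t.2 → x i = 0) := by
  simp only [cubeFace, Set.mem_Icc, Pi.le_def, ← forall_and]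
  refine forall_congr' fun i => ?_
  simp only [Finset.piecewise, Finset.mem_union, Pi.one_apply, Pi.zero_apply]
  grind

theorem eq_of_mem_cubeFace {t : Finset ι × Finset ι} {x y : ι → ℝ} (hx : x ∈ cubeFace t)
    (hy : y ∈ cubeFace t) {i : ι} (hi : i ∈ t.1 ∨ i ∉ t.2) : x i = y i := by
  have hx := (mem_cubeFace.1 hx i).2
  have hy := (mem_cubeFace.1 hy i).2
  by_cases h1 : i ∈ t.1
  · rw [hx.1 h1, hy.1 h1]
  · rw [hx.2 h1 (hi.resolve_left h1), hy.2 h1 (hi.resolve_left h1)]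

theorem mem_of_mem_cubeFace {t : Finset ι × Finset ι} {x : ι → ℝ} (hx : x ∈ cubeFace t) {i : ι}
    (h0 : x i ≠ 0) (h1 : x i ≠ 1) : i ∈ t.2 := by
  have hx := (mem_cubeFace.1 hx i).2
  grind

theorem mem_cubeFace_compl [Fintype ι] {Q : Finset ι} {x : ι → ℝ} :
    x ∈ cubeFace (∅, Qᶜ) ↔ ∀ i, (0 ≤ x i ∧ x i ≤ 1) ∧ (i ∈ Q → x i = 0) := by
  simp [mem_cubeFace]

theorem piecewise_one_mem_cubeFace {I B : Finset ι} {x : ι → ℝ}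
    (hx : x ∈ cubeFace (∅, B)) : I.piecewise (1 : ι → ℝ) x ∈ cubeFace (I, B) :=
  mem_cubeFace.2 fun i => by
    have hxi := mem_cubeFace.1 hx i
    by_cases hi : i ∈ I <;> simp_all

/-- The union of the faces of the cube with labels in `P`. -/
def faceUnion (P : Set (Finset ι × Finset ι)) : Set (ι → ℝ) := ⋃ t ∈ P, cubeFace t

theorem mem_faceUnion {P : Set (Finset ι × Finset ι)} {x : ι → ℝ} :
    x ∈ faceUnion P ↔ ∃ t ∈ P, x ∈ cubeFace t := by
  simp [faceUnion]

/-- Deletion of the coordinates with index in `Q`, which are set to `0`. -/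
abbrev zeroOn (Q : Finset ι) (x : ι → ℝ) : ι → ℝ := Q.piecewise 0 x

theorem zeroOn_singleton (q : ι) (x : ι → ℝ) : zeroOn {q} x = Function.update x q 0 :=
  Finset.piecewise_singleton _ _ _

theorem zeroOn_eq_self {Q B : Finset ι} (h : Disjoint Q B) {x : ι → ℝ}
    (hx : x ∈ cubeFace (∅, B)) : zeroOn Q x = x := by
  ext i
  by_cases hi : i ∈ Q
  · simp [hi, (mem_cubeFace.1 hx i).2.2 (by simp) (Finset.disjoint_left.1 h hi)]
  · simp [hi]

/-- The label of the face obtained from the face with label `t` by setting the coordinates with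
index in `Q` to `0`. -/
def deleteLabel (Q : Finset ι) (t : Finset ι × Finset ι) : Finset ι × Finset ι :=
  (t.1 \ Q, t.2 \ Q)

theorem cubeFace_deleteLabel (Q : Finset ι) (t : Finset ι × Finset ι) :
    cubeFace (deleteLabel Q t) = zeroOn Q '' cubeFace t := by
  ext y
  constructor
  · intro hy
    refine ⟨(Q ∩ t.1).piecewise 1 y, mem_cubeFace.2 fun i => ?_, ?_⟩
    · have hyi := mem_cubeFace.1 hy i
      by_cases hQ : i ∈ Q <;> by_cases h1 : i ∈ t.1 <;> simp_all [deleteLabel]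
    · ext i
      have hyi := mem_cubeFace.1 hy i
      by_cases hQ : i ∈ Q <;> by_cases h1 : i ∈ t.1 <;> simp_all [deleteLabel]
  · rintro ⟨x, hx, rfl⟩
    refine mem_cubeFace.2 fun i => ?_
    have hxi := mem_cubeFace.1 hx i
    by_cases hQ : i ∈ Q <;> simp_all [deleteLabel]

theorem faceUnion_image_deleteLabel (Q : Finset ι) (P : Set (Finset ι × Finset ι)) :
    faceUnion (deleteLabel Q '' P) = zeroOn Q '' faceUnion P := by
  simp only [faceUnion, Set.biUnion_image, cubeFace_deleteLabel, Set.image_iUnion₂]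

theorem deleteLabel_insert (q : ι) (Q : Finset ι) (t : Finset ι × Finset ι) :
    deleteLabel (insert q Q) t = deleteLabel {q} (deleteLabel Q t) := by
  ext <;> simp [deleteLabel] <;> tauto

/-- The `q`-th coordinate grows from `x` to `y` by at most `s`, and if it grows by `s`, then no
other coordinate changes. -/
structure Advances (q : ι) (s : ℝ) (x y : ι → ℝ) : Prop where
  le : x q ≤ y q
  le_add : y q ≤ x q + s
  eq_add_single : y q = x q + s → y = x + Pi.single q s

theorem Advances.trans {q : ι} {s s' : ℝ} {x y z : ι → ℝ} (h : Advances q s x y)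
    (h' : Advances q s' y z) : Advances q (s + s') x z where
  le := h.le.trans h'.le
  le_add := by linarith [h.le_add, h'.le_add]
  eq_add_single hz := by
    rw [h'.eq_add_single (by linarith [h.le_add, h'.le_add]),
      h.eq_add_single (by linarith [h.le_add, h'.le_add]), add_assoc, ← Pi.single_add]

end Cube

section Sections

variable {ι E : Type*} [Fintype ι] [AddCommGroup E] [Module ℝ E]

/-- The projection `x ↦ ∑ x_i v_i`, which maps the cube `[0, 1]^ι` onto the zonotope of `v`. -/
abbrev comb (v : ι → E) : (ι → ℝ) →ₗ[ℝ] E := Fintype.linearCombination ℝ v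

theorem map_comb (v : ι → E) (f : E →ₗ[ℝ] ℝ) (x : ι → ℝ) :
    f (comb v x) = ∑ i, x i * f (v i) := by
  simp [Fintype.linearCombination_apply]

theorem lt_one_of_map_comb_lt {v : ι → E} {f : E →ₗ[ℝ] ℝ} (hf : ∀ i, 0 < f (v i))
    {Q : Finset ι} {z : ι → ℝ} (hz : 0 ≤ z) (hQ : ∀ i ∈ Q, z i = 1) {i : ι} (hi : i ∉ Q)
    (hlt : f (comb v z) < ∑ j ∈ Q, f (v j) + f (v i)) : z i < 1 := by
  classical
  by_contra! hle
  refine hlt.not_ge ?_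
  calc ∑ j ∈ Q, f (v j) + f (v i) ≤ ∑ j ∈ Q, z j * f (v j) + z i * f (v i) := by
        refine add_le_add (Finset.sum_le_sum fun j hj => ?_)
          (le_mul_of_one_le_left (hf i).le hle)
        rw [hQ j hj, one_mul]
    _ = ∑ j ∈ insert i Q, z j * f (v j) := by rw [Finset.sum_insert hi, add_comm]
    _ ≤ ∑ j, z j * f (v j) := Finset.sum_le_univ_sum_of_nonneg fun j =>
        mul_nonneg (hz j) (hf j).le
    _ = f (comb v z) := (map_comb v f z).symm

theorem eq_of_comb_eq {v : ι → E} {B : Finset ι} (hB : LinearIndepOn ℝ v (B : Set ι))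
    {x y : ι → ℝ} (hoff : ∀ i ∉ B, x i = y i) (h : comb v x = comb v y) : x = y := by
  have hsum : ∑ i ∈ B, (x - y) i • v i = 0 := by
    rw [Finset.sum_subset B.subset_univ fun i _ hi => by simp [hoff i hi],
      ← Fintype.linearCombination_apply, map_sub, h, sub_self]
  ext i
  by_cases hi : i ∈ B
  · exact sub_eq_zero.1 (linearIndepOn_finset_iff.1 hB _ hsum i hi)
  · exact hoff i hi

variable [DecidableEq ι]

theorem comb_update (v : ι → E) (x : ι → ℝ) (q : ι) :
    comb v (Function.update x q 0) + x q • v q = comb v x := by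
  rw [← Fintype.linearCombination_apply_single ℝ v, ← map_add]
  congr 1
  ext i
  by_cases hi : i = q
  · subst hi; simp
  · simp [hi]

theorem comb_eq_add_smul {v : ι → E} {x y : ι → ℝ} {q : ι}
    (hxy : comb v (Function.update x q 0) = comb v (Function.update y q 0)) :
    comb v y = comb v x + (y q - x q) • v q := by
  rw [← comb_update v y q, ← comb_update v x q, hxy, sub_smul]
  abel

/-- A family of faces of the cube, of any dimension, that is the image of a section of the
projection of the face `x_Q = 0` onto the zonotope of the vectors with index outside `Q`. -/
structure IsSection (v : ι → E) (Q : Finset ι) (P : Set (Finset ι × Finset ι)) : Prop where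
  linearIndepOn : ∀ t ∈ P, LinearIndepOn ℝ v (t.2 : Set ι)
  subset : faceUnion P ⊆ cubeFace (∅, Qᶜ)
  injOn : Set.InjOn (comb v) (faceUnion P)
  surjOn : Set.SurjOn (comb v) (faceUnion P) (comb v '' cubeFace (∅, Qᶜ))

/-- The section of the projection with values in `faceUnion P`; it has junk values outside the
zonotope. -/
def sectionMap (v : ι → E) (P : Set (Finset ι × Finset ι)) : E → ι → ℝ :=
  Function.invFunOn (comb v) (faceUnion P)

theorem advances_of_mem_cubeFace {v : ι → E} {t : Finset ι × Finset ι}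
    (ht : LinearIndepOn ℝ v (t.2 : Set ι)) {x y : ι → ℝ} (hx : x ∈ cubeFace t)
    (hy : y ∈ cubeFace t) {q : ι} {s : ℝ} (hs : 0 ≤ s) (hxy : comb v y = comb v x + s • v q) :
    Advances q s x y := by
  by_cases hq : q ∈ t.1 ∨ q ∉ t.2
  · have hyq : y q = x q := eq_of_mem_cubeFace hy hx hq
    refine ⟨hyq.ge, by linarith, fun h => ?_⟩
    obtain rfl : s = 0 := by linarith
    simpa using eq_of_comb_eq ht (fun i hi => eq_of_mem_cubeFace hy hx (.inr hi))
      (by simpa using hxy)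
  · push Not at hq
    have hy' : y = x + Pi.single q s := by
      refine eq_of_comb_eq ht (fun i hi => ?_) ?_
      · have hiq : i ≠ q := fun h => hi (h ▸ hq.2)
        simp [eq_of_mem_cubeFace hy hx (.inr hi), hiq]
      · rw [hxy, map_add, Fintype.linearCombination_apply_single]
    refine ⟨?_, ?_, fun _ => hy'⟩ <;> simp [hy', hs]

namespace IsSection

variable {v : ι → E} {Q : Finset ι} {P : Set (Finset ι × Finset ι)}

theorem sectionMap_mem (h : IsSection v Q P) {p : E} (hp : p ∈ comb v '' cubeFace (∅, Qᶜ)) :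
    sectionMap v P p ∈ faceUnion P :=
  Function.invFunOn_mem (h.surjOn hp)

theorem comb_sectionMap (h : IsSection v Q P) {p : E} (hp : p ∈ comb v '' cubeFace (∅, Qᶜ)) :
    comb v (sectionMap v P p) = p :=
  Function.invFunOn_eq (h.surjOn hp)

theorem sectionMap_comb (h : IsSection v Q P) {x : ι → ℝ} (hx : x ∈ faceUnion P) :
    sectionMap v P (comb v x) = x :=
  h.injOn.leftInvOn_invFunOn hx

end IsSection

theorem comb_piecewise (v : ι → E) (Q : Finset ι) (x : ι → ℝ) :
    comb v (Q.piecewise 1 x) = ∑ i ∈ Q, v i + comb v (zeroOn Q x) := by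
  simp [Fintype.linearCombination_apply, Finset.piecewise, ite_smul, Finset.sum_ite]

theorem comb_piecewise_zero (v : ι → E) (B : Finset ι) (x : ι → ℝ) :
    comb (B.piecewise v 0) x = comb v (B.piecewise x 0) := by
  simp [Fintype.linearCombination_apply, Finset.piecewise, ite_smul, smul_ite]

theorem comb_piecewise_zero_surjective [FiniteDimensional ℝ E] {v : ι → E} {B : Finset ι}
    (hB : LinearIndepOn ℝ v (B : Set ι)) (hcard : B.card = Module.finrank ℝ E) :
    Function.Surjective (comb (B.piecewise v 0)) := by
  rw [← LinearMap.range_eq_top, Fintype.range_linearCombination, eq_top_iff,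
    ← hB.linearIndependent.span_eq_top_of_card_eq_finrank' (by simpa using hcard)]
  refine Submodule.span_mono ?_
  rintro _ ⟨b, rfl⟩
  exact ⟨b, by simp⟩

theorem IsSection.exists_mem_fst_eq_empty {v : ι → E} {f : E →ₗ[ℝ] ℝ} (hf : ∀ i, 0 < f (v i))
    {P : Set (Finset ι × Finset ι)} (h : IsSection v ∅ P) :
    ∃ t ∈ P, t.1 = ∅ ∧ 0 ∈ cubeFace t := by
  obtain ⟨x, hx, hx0⟩ := h.surjOn ⟨0, mem_cubeFace_compl.2 (by simp), map_zero _⟩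
  obtain ⟨t, ht, hxt⟩ := mem_faceUnion.1 hx
  have hsum : ∑ i, x i * f (v i) = 0 := by rw [← map_comb, hx0, map_zero]
  obtain rfl : x = 0 := by
    ext i
    have hterm := (Finset.sum_eq_zero_iff_of_nonneg fun i _ =>
      mul_nonneg (mem_cubeFace.1 hxt i).1.1 (hf i).le).1 hsum i (Finset.mem_univ i)
    exact (mul_eq_zero.1 hterm).resolve_right (hf i).ne'
  refine ⟨t, ht, Finset.eq_empty_of_forall_notMem fun i hi => ?_, hxt⟩
  simpa using (mem_cubeFace.1 hxt i).2.1 hi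

theorem finrank_le_card_add_one_of_comb_eq {v : ι → E} {Q : Finset ι} {z : ι → ℝ} {u : E}
    (hz : ∀ i ∈ Q, z i = 1) {r : ℝ} (hr : r ≠ 0) (hcomb : comb v z = r • (∑ i ∈ Q, v i + u))
    (hu : ∀ C : Finset ι, C.card + 1 < Module.finrank ℝ E →
      u ∉ Submodule.span ℝ (insert (∑ i ∈ Q, v i) (v '' C))) :
    Module.finrank ℝ E ≤ ({i | i ∉ Q ∧ z i ≠ 0} : Finset ι).card + 1 := by
  by_contra! hlt
  refine hu _ hlt ?_
  set C : Finset ι := {i | i ∉ Q ∧ z i ≠ 0} with hC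
  set W := Submodule.span ℝ (insert (∑ i ∈ Q, v i) (v '' C))
  have hQ : ∑ i ∈ Q, v i ∈ W := Submodule.subset_span (Set.mem_insert _ _)
  have hrest : comb v (zeroOn Q z) ∈ W := by
    rw [Fintype.linearCombination_apply]
    refine Submodule.sum_mem _ fun i _ => ?_
    by_cases hi : i ∈ C
    · exact W.smul_mem _ (Submodule.subset_span (.inr ⟨i, hi, rfl⟩))
    · have hzi : zeroOn Q z i = 0 := by
        by_cases hiQ : i ∈ Q <;> simp_all
      simp [hzi]
  have hsplit : comb v z = ∑ i ∈ Q, v i + comb v (zeroOn Q z) := by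
    rw [← comb_piecewise]
    congr 1
    ext i
    by_cases hi : i ∈ Q <;> simp [hi, hz]
  have hu_eq : u = r⁻¹ • comb v z - ∑ i ∈ Q, v i := by
    rw [hcomb, inv_smul_smul₀ hr, add_sub_cancel_left]
  rw [hu_eq, hsplit]
  exact W.sub_mem (W.smul_mem _ (W.add_mem hQ hrest)) hQ

variable [TopologicalSpace E] [IsTopologicalAddGroup E] [ContinuousSMul ℝ E] [T2Space E]

theorem isClosed_image_cubeFace (v : ι → E) (t : Finset ι × Finset ι) :
    IsClosed (comb v '' cubeFace t) :=
  (isCompact_Icc.image (comb v).continuous_of_finiteDimensional).isClosed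

theorem isClosed_image_faceUnion (v : ι → E) (R : Set (Finset ι × Finset ι)) :
    IsClosed (comb v '' faceUnion R) := by
  rw [faceUnion, Set.image_iUnion₂]
  exact R.toFinite.isClosed_biUnion fun t _ => isClosed_image_cubeFace v t

namespace IsSection

variable {v : ι → E} {Q : Finset ι} {P : Set (Finset ι × Finset ι)}

theorem advances (h : IsSection v Q P) {q : ι} {s : ℝ} (hs : 0 ≤ s) {z : E}
    (hz : z ∈ comb v '' cubeFace (∅, Qᶜ)) (hz' : z + s • v q ∈ comb v '' cubeFace (∅, Qᶜ)) :
    Advances q s (sectionMap v P z) (sectionMap v P (z + s • v q)) := by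
  have hseg : ∀ r ∈ Set.Icc 0 s, z + r • v q ∈ comb v '' cubeFace (∅, Qᶜ) := fun r hr =>
    add_smul_mem_of_convex ((convex_Icc _ _).linear_image _) hz hz' hr
  have hadv := rel_of_finite_closed_cover
    (R := fun r r' => Advances q (r' - r) (sectionMap v P (z + r • v q))
      (sectionMap v P (z + r' • v q)))
    (fun h₁ h₂ => by simpa using h₁.trans h₂)
    (S := fun t => {r : ℝ | z + r • v q ∈ comb v '' cubeFace t})
    (fun t => (isClosed_image_cubeFace v t).preimage (by fun_prop)) P.toFinite.toFinset hs ?_ ?_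
  · simpa using hadv
  · intro r hr
    obtain ⟨x, hx, hxr⟩ := h.surjOn (hseg r hr)
    obtain ⟨t, ht, hxt⟩ := mem_faceUnion.1 hx
    exact Set.mem_biUnion (by simpa using ht) ⟨x, hxt, hxr⟩
  · rintro t ht r ⟨x, hx, hxr⟩ r' ⟨y, hy, hyr⟩ - hrr' -
    have ht : t ∈ P := by simpa using ht
    simp only [← hxr, ← hyr, h.sectionMap_comb (mem_faceUnion.2 ⟨t, ht, hx⟩),
      h.sectionMap_comb (mem_faceUnion.2 ⟨t, ht, hy⟩)]
    refine advances_of_mem_cubeFace (h.linearIndepOn t ht) hx hy (sub_nonneg.2 hrr') ?_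
    rw [hxr, hyr, sub_smul]
    abel

theorem add_single_mem_faceUnion (h : IsSection v Q P) {x y : ι → ℝ} (hx : x ∈ faceUnion P)
    (hy : y ∈ faceUnion P) {q : ι} (hxy : comb v y = comb v x + (y q - x q) • v q) {r : ℝ}
    (hr : r ∈ Set.Icc 0 (y q - x q)) : x + Pi.single q r ∈ faceUnion P := by
  have hmem : comb v x + r • v q ∈ comb v '' cubeFace (∅, Qᶜ) :=
    add_smul_mem_of_convex ((convex_Icc _ _).linear_image _) ⟨x, h.subset hx, rfl⟩
      (by rw [← hxy]; exact ⟨y, h.subset hy, rfl⟩) hr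
  have hlow := h.advances hr.1 ⟨x, h.subset hx, rfl⟩ hmem
  have hhigh := h.advances (sub_nonneg.2 hr.2) hmem (by
    rw [add_assoc, ← add_smul, add_sub_cancel, ← hxy]; exact ⟨y, h.subset hy, rfl⟩)
  rw [add_assoc, ← add_smul, add_sub_cancel, ← hxy] at hhigh
  rw [h.sectionMap_comb hx] at hlow
  rw [h.sectionMap_comb hy] at hhigh
  rw [← hlow.eq_add_single (le_antisymm hlow.le_add (by linarith [hhigh.le_add]))]
  exact h.sectionMap_mem hmem

theorem update_eq_update (h : IsSection v Q P) {x y : ι → ℝ} (hx : x ∈ faceUnion P)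
    (hy : y ∈ faceUnion P) {q : ι}
    (hxy : comb v (Function.update x q 0) = comb v (Function.update y q 0)) :
    Function.update x q 0 = Function.update y q 0 := by
  wlog hle : x q ≤ y q generalizing x y
  · exact (this hy hx hxy.symm (le_of_not_ge hle)).symm
  have hcomb := comb_eq_add_smul hxy
  have hmem := h.add_single_mem_faceUnion hx hy hcomb ⟨sub_nonneg.2 hle, le_rfl⟩
  have hy_eq : x + Pi.single q (y q - x q) = y := h.injOn hmem hy <| by
    rw [map_add, Fintype.linearCombination_apply_single, hcomb]
  rw [← hy_eq]
  ext i
  by_cases hi : i = q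
  · subst hi; simp
  · simp [hi]

theorem eq_of_comb_update_eq (h : IsSection v Q P) [FiniteDimensional ℝ E] {x y : ι → ℝ}
    (hx : x ∈ faceUnion P) (hy : y ∈ faceUnion P) {q : ι} {F : Finset ι}
    (hF : Module.finrank ℝ E ≤ F.card) (hqF : q ∉ F) (hfrac : ∀ i ∈ F, 0 < x i ∧ x i < 1)
    (hxy : comb v (Function.update x q 0) = comb v (Function.update y q 0)) : x = y := by
  have hoff : ∀ i ≠ q, x i = y i := fun i hi => by
    simpa [hi] using congrFun (h.update_eq_update hx hy hxy) i
  wlog hle : x q ≤ y q generalizing x y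
  · refine (this hy hx (fun i hi => ?_) hxy.symm (fun i hi => (hoff i hi).symm)
      (le_of_not_ge hle)).symm
    rw [← hoff i (ne_of_mem_of_not_mem hi hqF)]
    exact hfrac i hi
  rcases hle.eq_or_lt with heq | hlt
  · ext i
    by_cases hi : i = q
    · rw [hi, heq]
    · exact hoff i hi
  have hcomb := comb_eq_add_smul hxy
  -- The midpoint of `x` and `y` has more fractional coordinates than the dimension allows.
  obtain ⟨t, ht, hmid⟩ := mem_faceUnion.1 (h.add_single_mem_faceUnion hx hy hcomb
    (r := (y q - x q) / 2) ⟨by linarith, by linarith⟩)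
  have hx0 := (mem_cubeFace.1 (h.subset hx) q).1
  have hy1 := (mem_cubeFace.1 (h.subset hy) q).1
  have hsub : insert q F ⊆ t.2 := by
    refine Finset.insert_subset ?_ fun i hi => ?_
    · apply mem_of_mem_cubeFace hmid <;> simp only [Pi.add_apply, Pi.single_eq_same] <;>
        linarith
    · have hiq : i ≠ q := ne_of_mem_of_not_mem hi hqF
      apply mem_of_mem_cubeFace hmid <;>
        simp only [Pi.add_apply, Pi.single_eq_of_ne hiq, add_zero]
      exacts [(hfrac i hi).1.ne', (hfrac i hi).2.ne]
  have hcard := Finset.card_le_card hsub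
  have hdim : t.2.card ≤ Module.finrank ℝ E := by
    simpa using (h.linearIndepOn t ht).linearIndependent.fintype_card_le_finrank
  rw [Finset.card_insert_of_notMem hqF] at hcard
  omega

theorem continuousOn_sectionMap (h : IsSection v Q P) (z : E) (q : ι) :
    ContinuousOn (fun r : ℝ => sectionMap v P (z + r • v q) q)
      {r | z + r • v q ∈ comb v '' cubeFace (∅, Qᶜ)} := by
  have hadv : ∀ r s : ℝ, z + r • v q ∈ comb v '' cubeFace (∅, Qᶜ) →
      z + s • v q ∈ comb v '' cubeFace (∅, Qᶜ) → r ≤ s → Advances q (s - r)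
        (sectionMap v P (z + r • v q)) (sectionMap v P (z + s • v q)) := fun r s hr hs hrs => by
    have hstep : z + s • v q = z + r • v q + (s - r) • v q := by
      rw [add_assoc, ← add_smul, add_sub_cancel]
    rw [hstep] at hs ⊢
    exact h.advances (sub_nonneg.2 hrs) hr hs
  refine (LipschitzOnWith.of_le_add fun r hr s hs => ?_).continuousOn
  rcases le_total r s with hrs | hsr
  · linarith [(hadv r s hr hs hrs).le, dist_nonneg (x := r) (y := s)]
  · linarith [(hadv s r hs hr hsr).le_add, le_abs_self (r - s), Real.dist_eq r s]

theorem exists_comb_update_eq (h : IsSection v Q P) {q : ι} (hq : q ∉ Q) {p : E}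
    (hp : p ∈ comb v '' cubeFace (∅, (insert q Q)ᶜ)) :
    ∃ x ∈ faceUnion P, comb v (Function.update x q 0) = p := by
  obtain ⟨w, hw, rfl⟩ := hp
  have hmem : ∀ r ∈ Set.Icc (0 : ℝ) 1, comb v w + r • v q ∈ comb v '' cubeFace (∅, Qᶜ) := by
    intro r hr
    refine ⟨w + Pi.single q r, mem_cubeFace_compl.2 fun i => ?_, by
      rw [map_add, Fintype.linearCombination_apply_single]⟩
    have hwi := mem_cubeFace_compl.1 hw i
    by_cases hi : i = q
    · subst hi
      have hwq := hwi.2 (Finset.mem_insert_self _ _)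
      simp_all
    · simp_all
  -- A fixed point is a point of the section that deleting its `q`-th coordinate sends to `w`.
  obtain ⟨r, hr, hfix⟩ := exists_mem_Icc_isFixedPt_of_mapsTo
    ((h.continuousOn_sectionMap (comb v w) q).mono hmem) zero_le_one fun r hr =>
      (mem_cubeFace.1 (h.subset (h.sectionMap_mem (hmem r hr))) q).1
  refine ⟨_, h.sectionMap_mem (hmem r hr), ?_⟩
  have hcomb := comb_update v (sectionMap v P (comb v w + r • v q)) q
  rw [h.comb_sectionMap (hmem r hr),
    show sectionMap v P (comb v w + r • v q) q = r from hfix] at hcomb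
  exact add_right_cancel hcomb

theorem delete_singleton (h : IsSection v Q P) {q : ι} (hq : q ∉ Q) :
    IsSection v (insert q Q) (deleteLabel {q} '' P) where
  linearIndepOn := by
    rintro _ ⟨t, ht, rfl⟩
    exact (h.linearIndepOn t ht).mono (by simp [deleteLabel])
  subset := by
    rw [faceUnion_image_deleteLabel]
    rintro _ ⟨x, hx, rfl⟩
    refine mem_cubeFace_compl.2 fun i => ?_
    have hxi := mem_cubeFace_compl.1 (h.subset hx) i
    by_cases hi : i = q <;> simp_all
  injOn := by
    rw [faceUnion_image_deleteLabel]
    rintro _ ⟨x, hx, rfl⟩ _ ⟨y, hy, rfl⟩ hxy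
    simp only [zeroOn_singleton] at hxy ⊢
    exact h.update_eq_update hx hy hxy
  surjOn := by
    intro p hp
    obtain ⟨x, hx, hxp⟩ := h.exists_comb_update_eq hq hp
    rw [faceUnion_image_deleteLabel]
    exact ⟨_, ⟨x, hx, rfl⟩, by simpa [zeroOn_singleton] using hxp⟩

theorem delete (h : IsSection v ∅ P) (Q : Finset ι) : IsSection v Q (deleteLabel Q '' P) := by
  induction Q using Finset.induction_on with
  | empty =>
    rwa [show deleteLabel (∅ : Finset ι) = id from funext fun t => by simp [deleteLabel],
      Set.image_id]
  | @insert q Q hq ih =>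
    rw [show deleteLabel (insert q Q) = deleteLabel {q} ∘ deleteLabel Q from
      funext (deleteLabel_insert q Q), Set.image_comp]
    exact ih.delete_singleton hq

theorem eq_of_comb_zeroOn_eq [FiniteDimensional ℝ E] (h : IsSection v ∅ P) {x y : ι → ℝ}
    (hx : x ∈ faceUnion P) (hy : y ∈ faceUnion P) {F : Finset ι}
    (hF : Module.finrank ℝ E ≤ F.card) (hfrac : ∀ i ∈ F, 0 < x i ∧ x i < 1)
    (hQF : Disjoint Q F) (hxy : comb v (zeroOn Q x) = comb v (zeroOn Q y)) : x = y := by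
  induction Q using Finset.induction_on with
  | empty => exact h.injOn hx hy (by simpa using hxy)
  | @insert q Q _ ih =>
    rw [Finset.disjoint_insert_left] at hQF
    have hmem : ∀ z ∈ faceUnion P, zeroOn Q z ∈ faceUnion (deleteLabel Q '' P) :=
      fun z hz => by rw [faceUnion_image_deleteLabel]; exact ⟨z, hz, rfl⟩
    refine ih hQF.2 (congrArg (comb v) ((h.delete Q).eq_of_comb_update_eq (hmem x hx) (hmem y hy)
      hF hQF.1 (fun i hi => ?_) ?_))
    · rw [zeroOn, Finset.piecewise_eq_of_notMem _ _ _ (Finset.disjoint_right.1 hQF.2 hi)]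
      exact hfrac i hi
    · simpa only [zeroOn, Finset.piecewise_insert, Pi.zero_apply] using hxy

theorem exists_mem_faceUnion_inter (h : IsSection v Q P) {R : Set (Finset ι × Finset ι)}
    (hR : R ⊆ P) {S : Set E} (hS : IsPreconnected S) (hSZ : S ⊆ comb v '' cubeFace (∅, Qᶜ))
    (hin : (S ∩ comb v '' faceUnion R).Nonempty)
    (hout : (S ∩ comb v '' faceUnion (P \ R)).Nonempty) :
    ∃ z ∈ faceUnion R ∩ faceUnion (P \ R), comb v z ∈ S := by
  have hunion : faceUnion R ∪ faceUnion (P \ R) = faceUnion P := by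
    rw [faceUnion, faceUnion, ← Set.biUnion_union, Set.union_sdiff_cancel hR, faceUnion]
  have hcover : S ⊆ comb v '' faceUnion R ∪ comb v '' faceUnion (P \ R) := by
    rw [← Set.image_union, hunion]
    exact hSZ.trans h.surjOn
  obtain ⟨_, hpS, ⟨x, hx, rfl⟩, ⟨y, hy, hxy⟩⟩ := isPreconnected_closed_iff.1 hS _ _
    (isClosed_image_faceUnion v R) (isClosed_image_faceUnion v (P \ R)) hcover hin hout
  obtain rfl : y = x := h.injOn (hunion ▸ .inr hy) (hunion ▸ .inl hx) hxy
  exact ⟨y, ⟨hx, hy⟩, hpS⟩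

end IsSection

theorem exists_comb_generic [FiniteDimensional ℝ E] {v : ι → E} {f : E →ₗ[ℝ] ℝ}
    (hf : ∀ i, 0 < f (v i)) {B : Finset ι} (hB : LinearIndepOn ℝ v (B : Set ι))
    (hcard : B.card = Module.finrank ℝ E) {𝒲 : Set (Submodule ℝ E)} (hfin : 𝒲.Finite)
    (hproper : ∀ W ∈ 𝒲, W ≠ ⊤) :
    ∃ c ∈ cubeFace (∅, B), (∀ i, f (comb v c) < f (v i)) ∧ ∀ W ∈ 𝒲, comb v c ∉ W := by
  set L := comb (B.piecewise v 0) with hL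
  set O : Set (ι → ℝ) := ⋂ i, {c | c i < 1} ∩ {c | f (L c) < f (v i)}
  set O' : Set (ι → ℝ) := Set.univ.pi fun _ => Set.Ioi 0
  have hO : IsOpen O := isOpen_iInter_of_finite fun i =>
    (isOpen_lt (continuous_apply i) continuous_const).inter
      (isOpen_lt (f ∘ₗ L).continuous_of_finiteDimensional continuous_const)
  have hO' : IsOpen O' := isOpen_set_pi Set.finite_univ fun _ _ => isOpen_Ioi
  have hne : (O ∩ O').Nonempty := by
    have h0 : (0 : ι → ℝ) ∈ closure O' := by
      rw [closure_pi_set]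
      exact fun i _ => by simp
    exact mem_closure_iff.1 h0 O hO (Set.mem_iInter.2 fun i => by simp [hf i])
  obtain ⟨_, ⟨c, ⟨hcO, hcO'⟩, rfl⟩, hc𝒲⟩ := exists_mem_forall_notMem_submodule
    (L.isOpenMap_of_finiteDimensional (comb_piecewise_zero_surjective hB hcard) _
      (hO.inter hO')) (hne.image L) hfin hproper
  have hlt : ∀ i, c i < 1 ∧ f (L c) < f (v i) := Set.mem_iInter.1 hcO
  have hpos : ∀ i, 0 < c i := fun i => hcO' i (Set.mem_univ i)
  rw [hL, comb_piecewise_zero] at hc𝒲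
  refine ⟨B.piecewise c 0, mem_cubeFace.2 fun i => ?_,
    fun i => comb_piecewise_zero v B c ▸ (hlt i).2, hc𝒲⟩
  by_cases hi : i ∈ B <;> simp [hi, (hpos i).le, (hlt i).1.le]

theorem exists_comb_notMem_span [FiniteDimensional ℝ E] {v : ι → E} {f : E →ₗ[ℝ] ℝ}
    (hf : ∀ i, 0 < f (v i)) {B : Finset ι} (hB : LinearIndepOn ℝ v (B : Set ι))
    (hcard : B.card = Module.finrank ℝ E) (w : E) :
    ∃ c ∈ cubeFace (∅, B), (∀ i, f (comb v c) < f (v i)) ∧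
      ∀ C : Finset ι, C.card + 1 < Module.finrank ℝ E →
        comb v c ∉ Submodule.span ℝ (insert w (v '' C)) := by
  obtain ⟨c, hc, hclt, hgen⟩ := exists_comb_generic hf hB hcard
    (𝒲 := Set.range fun C : {C : Finset ι // C.card + 1 < Module.finrank ℝ E} =>
      Submodule.span ℝ (insert w (v '' C))) (Set.finite_range _)
    (Set.forall_mem_range.2 fun C => span_insert_image_ne_top C.2)
  exact ⟨c, hc, hclt, fun C hC => hgen _ ⟨⟨C, hC⟩, rfl⟩⟩

theorem IsSection.exists_crossing {v : ι → E} {f : E →ₗ[ℝ] ℝ}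
    (hf : ∀ i, 0 < f (v i)) {P : Set (Finset ι × Finset ι)} (h : IsSection v ∅ P)
    {Q B : Finset ι} (hQB : (Q, B) ∈ P) (hQ : Q.Nonempty) {x : ι → ℝ} (hx : x ∈ cubeFace (Q, B)) :
    ∃ t ∈ P, t.1 ≠ Q ∧ ∃ z ∈ cubeFace t, (∀ i ∈ Q, z i = 1) ∧
      ∃ r ∈ Set.Icc (0 : ℝ) 1, comb v z = r • comb v x := by
  set R := {t ∈ P | t.1 = Q}
  obtain ⟨t₀, ht₀, hempty, h0⟩ := h.exists_mem_fst_eq_empty hf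
  have h0R : (0 : ι → ℝ) ∈ faceUnion (P \ R) :=
    mem_faceUnion.2 ⟨t₀, ⟨ht₀, fun ht₀R => hQ.ne_empty (ht₀R.2.symm.trans hempty)⟩, h0⟩
  have hxR : x ∈ faceUnion R := mem_faceUnion.2 ⟨_, ⟨hQB, rfl⟩, hx⟩
  have hseg : segment ℝ 0 (comb v x) ⊆ comb v '' cubeFace (∅, ∅ᶜ) :=
    ((convex_Icc _ _).linear_image (comb v)).segment_subset
      ⟨0, mem_cubeFace_compl.2 (by simp), map_zero _⟩
      ⟨x, h.subset (mem_faceUnion.2 ⟨_, hQB, hx⟩), rfl⟩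
  obtain ⟨z, ⟨hzR, hzR'⟩, hzx⟩ := h.exists_mem_faceUnion_inter (Set.sep_subset _ _)
    (convex_segment _ _).isPreconnected hseg ⟨_, right_mem_segment _ _ _, x, hxR, rfl⟩
    ⟨0, left_mem_segment _ _ _, 0, h0R, map_zero _⟩
  obtain ⟨s, ⟨-, rfl⟩, hzs⟩ := mem_faceUnion.1 hzR
  obtain ⟨t, ⟨htP, htR⟩, hzt⟩ := mem_faceUnion.1 hzR'
  rw [segment_eq_image'] at hzx
  obtain ⟨r, hr, hrz⟩ := hzx
  exact ⟨t, htP, fun h => htR ⟨htP, h⟩, z, hzt, fun i hi => (mem_cubeFace.1 hzs i).2.1 hi, r, hr,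
    by simpa using hrz.symm⟩

theorem IsSection.exists_generic_crossing [FiniteDimensional ℝ E] {v : ι → E} {f : E →ₗ[ℝ] ℝ}
    (hf : ∀ i, 0 < f (v i)) {P : Set (Finset ι × Finset ι)} (h : IsSection v ∅ P)
    {Q B : Finset ι} (hQB : (Q, B) ∈ P) (hdisj : Disjoint Q B)
    (hcard : B.card = Module.finrank ℝ E) (hQ : Q.Nonempty) :
    ∃ t ∈ P, t.1 ≠ Q ∧ ∃ z ∈ cubeFace t, (∀ i ∈ Q, z i = 1) ∧ (∀ i ∉ Q, z i < 1) ∧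
      Module.finrank ℝ E ≤ ({i | i ∉ Q ∧ z i ≠ 0} : Finset ι).card + 1 := by
  obtain ⟨c, hc, hclt, hgen⟩ :=
    exists_comb_notMem_span hf (h.linearIndepOn _ hQB) hcard (∑ i ∈ Q, v i)
  obtain ⟨t, ht, htQ, z, hz, hz1, r, hr, hzr⟩ :=
    h.exists_crossing hf hQB hQ (piecewise_one_mem_cubeFace hc)
  have hz0 : 0 ≤ z := fun i => (mem_cubeFace.1 hz i).1.1
  rw [comb_piecewise, zeroOn_eq_self hdisj hc] at hzr
  have hsum : 0 < ∑ i ∈ Q, f (v i) := Finset.sum_pos (fun i _ => hf i) hQ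
  have hfr : f (comb v z) = r * (∑ i ∈ Q, f (v i) + f (comb v c)) := by
    rw [hzr, map_smul, map_add, map_sum, smul_eq_mul]
  have hfc : 0 ≤ f (comb v c) := by
    rw [map_comb]
    exact Finset.sum_nonneg fun i _ => mul_nonneg (mem_cubeFace.1 hc i).1.1 (hf i).le
  have hr0 : r ≠ 0 := by
    rintro rfl
    have hle : ∑ i ∈ Q, f (v i) ≤ f (comb v z) := by
      rw [map_comb]
      refine (Finset.sum_congr rfl fun i hi => by rw [hz1 i hi, one_mul]).symm.trans_le
        (Finset.sum_le_univ_sum_of_nonneg fun i => mul_nonneg (hz0 i) (hf i).le)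
    linarith
  refine ⟨t, ht, htQ, z, hz, hz1, fun i hi => lt_one_of_map_comb_lt hf hz0 hz1 hi ?_,
    finrank_le_card_add_one_of_comb_eq hz1 hr0 hzr hgen⟩
  nlinarith [hclt i, hr.1, hr.2]

theorem IsSection.exists_mem_erase [FiniteDimensional ℝ E] {v : ι → E} {f : E →ₗ[ℝ] ℝ}
    (hf : ∀ i, 0 < f (v i)) {P : Set (Finset ι × Finset ι)} (h : IsSection v ∅ P)
    {Q B : Finset ι} (hQB : (Q, B) ∈ P) (hdisj : Disjoint Q B)
    (hcard : B.card = Module.finrank ℝ E) (hQ : Q.Nonempty) :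
    ∃ b ∈ Q, ∃ B', (Q.erase b, B') ∈ P ∧ b ∈ B' := by
  obtain ⟨⟨I, B'⟩, ht, hIQ, z, hz, hz1, hzlt, hfin⟩ :=
    h.exists_generic_crossing hf hQB hdisj hcard hQ
  set C : Finset ι := {i | i ∉ Q ∧ z i ≠ 0}
  have hsub : I ⊆ Q := fun i hi => by
    by_contra hiQ
    exact (hzlt i hiQ).ne ((mem_cubeFace.1 hz i).2.1 hi)
  have hnew : Q \ I ⊆ B' := fun i hi => by
    rw [Finset.mem_sdiff] at hi
    by_contra hiB
    exact one_ne_zero ((hz1 i hi.1).symm.trans ((mem_cubeFace.1 hz i).2.2 hi.2 hiB))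
  have hC : C ⊆ B' := fun i hi => by
    have hi := (Finset.mem_filter.1 hi).2
    exact mem_of_mem_cubeFace hz hi.2 (hzlt i hi.1).ne
  have hdisj' : Disjoint (Q \ I) C := Finset.disjoint_left.2 fun i hi hiC =>
    (Finset.mem_filter.1 hiC).2.1 (Finset.mem_sdiff.1 hi).1
  have hB' : B'.card ≤ Module.finrank ℝ E := by
    simpa using (h.linearIndepOn _ ht).linearIndependent.fintype_card_le_finrank
  have hle := Finset.card_le_card (Finset.union_subset hnew hC)
  rw [Finset.card_union_of_disjoint hdisj'] at hle
  have hpos : 0 < (Q \ I).card := Finset.card_pos.2 <| Finset.sdiff_nonempty.2 fun hQI =>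
    hIQ (hsub.antisymm hQI)
  obtain ⟨b, hb⟩ := Finset.card_eq_one.1 (show (Q \ I).card = 1 by omega)
  have hbQI : b ∈ Q \ I := hb ▸ Finset.mem_singleton_self b
  refine ⟨b, (Finset.mem_sdiff.1 hbQI).1, B', ?_, hnew hbQI⟩
  rwa [← Finset.sdiff_singleton_eq_erase, ← hb, Finset.sdiff_sdiff_eq_self hsub]

end Sections

/-- The point of the cube with coordinates `1` on `I` and half those of `w` elsewhere. Halving
keeps the coordinates outside `I` below `1` when `w` are the weights of a convex combination. -/
def raise {ι : Type*} [DecidableEq ι] (I : Finset ι) (w : ι → ℝ) : ι → ℝ :=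
  I.piecewise 1 ((1 / 2 : ℝ) • w)

theorem zeroOn_raise {ι : Type*} [DecidableEq ι] {I Q : Finset ι} {w : ι → ℝ} (hI : I ⊆ Q)
    (hw : ∀ i ∈ Q, w i = 0) :
    zeroOn Q (raise I w) = (1 / 2 : ℝ) • w := by
  ext i
  by_cases hi : i ∈ Q
  · simp [hi, hw i hi]
  · simp [hi, raise, mt (@hI i) hi]

section ConvexWeights

variable {ι E : Type*} [Fintype ι] [AddCommGroup E] [Module ℝ E] {p : ι → E} {S : Set ι} {x : E}
  {w : ι → ℝ}

/-- The coefficients `w`, supported on `S`, express `x` as a convex combination of the points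
`p i`. They are indexed by the whole of `ι` so that weights on different sets `S` can be
compared. -/
structure IsConvexWeight (p : ι → E) (S : Set ι) (x : E) (w : ι → ℝ) : Prop where
  nonneg : ∀ i, 0 ≤ w i
  eq_zero : ∀ i ∉ S, w i = 0
  sum_eq_one : ∑ i, w i = 1
  sum_smul_eq : ∑ i, w i • p i = x

theorem mem_convexHull_image_iff :
    x ∈ convexHull ℝ (p '' S) ↔ ∃ w, IsConvexWeight p S x w := by
  classical
  constructor
  · let D : Set (ι → ℝ) := {w | (∀ i, 0 ≤ w i) ∧ (∀ i ∉ S, w i = 0) ∧ ∑ i, w i = 1}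
    have hD : Convex ℝ D := by
      rintro w ⟨hw0, hwS, hw1⟩ w' ⟨hw0', hwS', hw1'⟩ r s hr hs hrs
      refine ⟨fun i => add_nonneg (mul_nonneg hr (hw0 i)) (mul_nonneg hs (hw0' i)),
        fun i hi => by simp [hwS i hi, hwS' i hi], ?_⟩
      simp [Finset.sum_add_distrib, ← Finset.mul_sum, hw1, hw1', hrs]
    have hsub : p '' S ⊆ Fintype.linearCombination ℝ p '' D := by
      rintro _ ⟨i, hi, rfl⟩
      refine ⟨Pi.single i 1, ⟨(Pi.single_nonneg.2 zero_le_one : (0 : ι → ℝ) ≤ Pi.single i 1),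
        fun j hj => ?_, ?_⟩, ?_⟩
      · exact Pi.single_eq_of_ne (fun hji : j = i => hj (hji ▸ hi)) 1
      · simp
      · simp [Fintype.linearCombination_apply_single]
    intro hx
    obtain ⟨w, ⟨hw0, hwS, hw1⟩, hwx⟩ := convexHull_min hsub (hD.linear_image _) hx
    exact ⟨w, hw0, hwS, hw1, hwx⟩
  · rintro ⟨w, hw0, hwS, hw1, rfl⟩
    rw [← Finset.sum_subset (Finset.subset_univ (Finset.univ.filter (· ∈ S)))
      fun i _ hi => by simp [hwS i (by simpa using hi)]] at hw1 ⊢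
    exact (convex_convexHull ℝ _).sum_mem (fun i _ => hw0 i) hw1 fun i hi =>
      subset_convexHull ℝ _ ⟨i, by simpa using hi, rfl⟩

namespace IsConvexWeight

theorem mono {S' : Set ι} (hw : IsConvexWeight p S x w) (h : ∀ i ∉ S', w i = 0) :
    IsConvexWeight p S' x w :=
  ⟨hw.nonneg, h, hw.sum_eq_one, hw.sum_smul_eq⟩

theorem le_one (hw : IsConvexWeight p S x w) (i : ι) : w i ≤ 1 :=
  hw.sum_eq_one ▸ Finset.single_le_sum (fun j _ => hw.nonneg j) (Finset.mem_univ i)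

theorem half_smul_mem_cubeFace [DecidableEq ι] {B : Finset ι} (hw : IsConvexWeight p B x w) :
    (1 / 2 : ℝ) • w ∈ cubeFace (∅, B) := by
  refine mem_cubeFace.2 fun i => ⟨?_, fun hi => absurd hi (Finset.notMem_empty i), fun _ hi => ?_⟩
  · have h0 := hw.nonneg i
    have h1 := hw.le_one i
    constructor <;> simp only [Pi.smul_apply, smul_eq_mul] <;> linarith
  · simp [hw.eq_zero i hi]

end IsConvexWeight

variable [DecidableEq ι] {I : Finset ι}

theorem IsConvexWeight.raise_mem_cubeFace {B : Finset ι} (hw : IsConvexWeight p B x w) :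
    raise I w ∈ cubeFace (I, B) :=
  piecewise_one_mem_cubeFace hw.half_smul_mem_cubeFace

theorem IsConvexWeight.raise_lt_one_iff (hw : IsConvexWeight p S x w) {i : ι} :
    raise I w i < 1 ↔ i ∉ I := by
  have h1 := hw.le_one i
  by_cases hi : i ∈ I
  · simp [raise, hi]
  · simp only [raise, hi, not_false_eq_true, Finset.piecewise_eq_of_notMem, Pi.smul_apply,
      smul_eq_mul, iff_true]
    linarith

end ConvexWeights

variable {d n : ℕ}

section LiftedPoints

variable {a : Fin n → Pt d}

theorem comb_lift (a : Fin n → Pt d) (w : Fin n → ℝ) :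
    comb (lift a) w = (∑ i, w i • a i, ∑ i, w i) := by
  rw [Fintype.linearCombination_apply]
  refine Prod.ext ?_ ?_
  · rw [Prod.fst_sum]
    rfl
  · rw [Prod.snd_sum]
    simp [lift]

theorem IsConvexWeight.comb_lift {S : Set (Fin n)} {ξ : Pt d} {w : Fin n → ℝ}
    (hw : IsConvexWeight a S ξ w) : comb (lift a) w = (ξ, 1) := by
  rw [ZonotopalTiling.comb_lift, hw.sum_smul_eq, hw.sum_eq_one]

theorem finrank_pt_prod : Module.finrank ℝ (Pt d × ℝ) = d + 1 := by
  simp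

theorem comb_eq_of_mem_cubeFace {ι E : Type*} [Fintype ι] [DecidableEq ι] [AddCommGroup E]
    [Module ℝ E] {v : ι → E} {t : Finset ι × Finset ι} (ht : Disjoint t.1 t.2) {x : ι → ℝ}
    (hx : x ∈ cubeFace t) : comb v x = ∑ i ∈ t.1, v i + ∑ b ∈ t.2, x b • v b := by
  rw [mem_cubeFace] at hx
  have hone : ∑ i ∈ t.1, v i = ∑ i ∈ t.1, x i • v i :=
    Finset.sum_congr rfl fun i hi => by rw [(hx i).2.1 hi, one_smul]
  rw [hone, ← Finset.sum_union ht, Fintype.linearCombination_apply]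
  refine (Finset.sum_subset (Finset.subset_univ _) fun i _ hi => ?_).symm
  rw [Finset.notMem_union] at hi
  rw [(hx i).2.2 hi.1 hi.2, zero_smul]

theorem cell_eq_image {t : Label n} (ht : Disjoint t.1 t.2) :
    cell a t = comb (lift a) '' cubeFace t := by
  refine subset_antisymm ?_ ?_
  · rintro _ ⟨c, hc, rfl⟩
    have hmem : t.1.piecewise (1 : Fin n → ℝ) (t.2.piecewise c 0) ∈ cubeFace t := by
      refine piecewise_one_mem_cubeFace (mem_cubeFace.2 fun i => ?_)
      by_cases hi : i ∈ t.2
      · simpa [hi] using hc i hi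
      · simp [hi]
    refine ⟨_, hmem, (comb_eq_of_mem_cubeFace ht hmem).trans
      (congrArg _ (Finset.sum_congr rfl fun b hb => ?_))⟩
    simp [hb, Finset.disjoint_right.1 ht hb]
  · rintro _ ⟨x, hx, rfl⟩
    exact ⟨x, fun b _ => (mem_cubeFace.1 hx b).1, comb_eq_of_mem_cubeFace ht hx⟩

theorem zonotope_eq_image : zonotope a = comb (lift a) '' cubeFace (∅, ∅ᶜ) := by
  ext p
  simp only [zonotope, Set.mem_image, mem_cubeFace_compl, Finset.notMem_empty, IsEmpty.forall_iff,
    and_true, Fintype.linearCombination_apply, Set.mem_ofPred_eq, eq_comm (a := p)]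

theorem IsFace.cubeFace_subset {f t : Label n} (h : IsFace f t) : cubeFace f ⊆ cubeFace t := by
  obtain ⟨hfree, -, hone, hzero⟩ := h
  intro x hx
  rw [mem_cubeFace] at hx ⊢
  refine fun i => ⟨(hx i).1, fun hi => (hx i).2.1 (hone hi), fun hi hi' =>
    (hx i).2.2 (fun hif => ?_) fun hif => hi' (hfree hif)⟩
  exact (Finset.mem_union.1 (hzero hif)).elim hi hi'

namespace IsSimplexIndex

variable {B : Finset (Fin n)}

theorem linearIndepOn (hB : IsSimplexIndex a B) :
    LinearIndepOn ℝ (lift a) (B : Set (Fin n)) := by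
  rw [linearIndepOn_finset_iff]
  intro w hw i hi
  have hfst := congrArg Prod.fst hw
  have hsnd := congrArg Prod.snd hw
  rw [Prod.fst_sum, ← Finset.sum_coe_sort] at hfst
  rw [Prod.snd_sum, ← Finset.sum_coe_sort] at hsnd
  exact affineIndependent_iff.1 hB.2 Finset.univ (fun b => w b) (by simpa [lift] using hsnd) hfst
    ⟨i, hi⟩ (Finset.mem_univ _)

theorem affineSpan_eq_top (hB : IsSimplexIndex a B) :
    affineSpan ℝ (Set.range fun b : B => a b) = ⊤ := by
  rw [hB.2.affineSpan_eq_top_iff_card_eq_finrank_add_one]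
  simp [hB.1]

end IsSimplexIndex

theorem isClosed_simplex (a : Fin n → Pt d) (B : Finset (Fin n)) : IsClosed (simplex a B) :=
  ((B.finite_toSet.image a).isCompact_convexHull (𝕜 := ℝ)).isClosed

theorem simplex_eq_range (a : Fin n → Pt d) (B : Finset (Fin n)) :
    simplex a B = convexHull ℝ (Set.range fun b : B => a b) := by
  rw [simplex, Set.image_eq_range]
  rfl

theorem mem_simplex_iff {B : Finset (Fin n)} {ξ : Pt d} :
    ξ ∈ simplex a B ↔ ∃ w, IsConvexWeight a (B : Set (Fin n)) ξ w :=
  mem_convexHull_image_iff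

theorem interior_simplex_eq_empty {C : Finset (Fin n)} (hC : C.card ≤ d) :
    interior (simplex a C) = ∅ := by
  rw [← Set.not_nonempty_iff_eq_empty, simplex_eq_range,
    interior_convexHull_nonempty_iff_affineSpan_eq_top]
  intro htop
  have hne : Nonempty C := by
    by_contra hempty
    rw [not_nonempty_iff] at hempty
    simp [Set.range_eq_empty] at htop
  have hle := finrank_vectorSpan_range_add_one_le ℝ fun b : C => a b
  rw [← direction_affineSpan, htop, AffineSubspace.direction_top, finrank_top,
    finrank_euclideanSpace_fin, Fintype.card_coe] at hle
  exact absurd (hle.trans hC) (Nat.not_succ_le_self d)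

namespace IsSimplexIndex

variable {B : Finset (Fin n)}

theorem interior_nonempty (hB : IsSimplexIndex a B) : (interior (simplex a B)).Nonempty := by
  rw [simplex_eq_range, interior_convexHull_nonempty_iff_affineSpan_eq_top]
  exact hB.affineSpan_eq_top

theorem closure_interior (hB : IsSimplexIndex a B) :
    closure (interior (simplex a B)) = simplex a B := by
  have hconv : Convex ℝ (simplex a B) := convex_convexHull ℝ _
  rw [hconv.closure_interior_eq_closure_of_nonempty_interior hB.interior_nonempty,
    (isClosed_simplex a B).closure_eq]

theorem pos_of_mem_interior (hB : IsSimplexIndex a B) {ξ : Pt d}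
    (hξ : ξ ∈ interior (simplex a B)) {w : Fin n → ℝ}
    (hw : IsConvexWeight a (B : Set (Fin n)) ξ w) : ∀ i ∈ B, 0 < w i := by
  let e : AffineBasis B ℝ (Pt d) := ⟨fun b : B => a b, hB.2, hB.affineSpan_eq_top⟩
  have hcoord : ∀ b : B, 0 < e.coord b ξ := by
    rw [simplex_eq_range, show (fun b : B => a b) = e from rfl, e.interior_convexHull] at hξ
    exact hξ
  have hsum {M : Type} [AddCommMonoid M] (g : Fin n → M) (hg : ∀ i ∉ B, g i = 0) :
      ∑ b : B, g b = ∑ i, g i :=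
    (Finset.sum_coe_sort B g).trans (Finset.sum_subset (Finset.subset_univ B) fun i _ => hg i)
  have hone : ∑ b : B, w b = 1 := (hsum w hw.eq_zero).trans hw.sum_eq_one
  have hcomb : Finset.univ.affineCombination ℝ e (fun b : B => w b) = ξ := by
    rw [Finset.affineCombination_eq_linear_combination _ _ _ hone]
    exact (hsum (fun i => w i • a i) fun i hi => by simp [hw.eq_zero i hi]).trans hw.sum_smul_eq
  intro i hi
  have hwi := e.coord_apply_combination_of_mem (Finset.mem_univ ⟨i, hi⟩) hone
  rw [hcomb] at hwi
  exact hwi ▸ hcoord ⟨i, hi⟩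

end IsSimplexIndex

end LiftedPoints

/-- The simplices over the tiles of `P` with bottom vertex `I`. They triangulate the link region
of `I`. -/
def links (P : Set (Label n)) (I : Finset (Fin n)) : Set (Finset (Fin n)) := {B | (I, B) ∈ P}

/-- The bottom vertices of the tiles of `P` of order `k`. They are the family `𝓘^(k)` of the
construction. -/
def bottoms (P : Set (Label n)) (k : ℕ) : Set (Finset (Fin n)) :=
  {I | I.card = k ∧ ∃ B, (I, B) ∈ P}

/-- The tiles `Π_{I,B}` of `P` that become `Π_{∅,B}` when the vectors with index in `Q` are deleted.
Their simplices make up the regions `E^(r)(Q)`. -/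
def tilesOver (P : Set (Label n)) (Q : Finset (Fin n)) : Set (Label n) :=
  {t ∈ P | t.1 ⊆ Q ∧ Disjoint t.2 Q}

section Tilings

variable {a : Fin n → Pt d} {P : Set (Label n)} {Q : Finset (Fin n)} {ξ : Pt d}

theorem mem_linkRegion_iff_exists_tilesOver :
    ξ ∈ linkRegion a P Q ↔ ∃ t ∈ tilesOver P Q, t.1 = Q ∧ ξ ∈ simplex a t.2 := by
  simp only [linkRegion, region, ofOrder, Set.mem_iUnion₂, exists_prop]
  constructor
  · rintro ⟨t, ⟨⟨ht, hcard⟩, hdisj, hsub⟩, hξ⟩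
    exact ⟨t, ⟨ht, hsub, hdisj⟩, Finset.eq_of_subset_of_card_le hsub hcard.ge, hξ⟩
  · rintro ⟨t, ⟨ht, hsub, hdisj⟩, rfl, hξ⟩
    exact ⟨t, ⟨⟨ht, rfl⟩, hdisj, hsub⟩, hξ⟩

theorem mem_biUnion_region_iff :
    ξ ∈ ⋃ r ∈ Finset.range Q.card, region a P r Q ↔
      ∃ t ∈ tilesOver P Q, t.1 ≠ Q ∧ ξ ∈ simplex a t.2 := by
  simp only [region, ofOrder, Set.mem_iUnion₂, exists_prop, Finset.mem_range]
  constructor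
  · rintro ⟨r, hr, t, ⟨⟨ht, hcard⟩, hdisj, hsub⟩, hξ⟩
    exact ⟨t, ⟨ht, hsub, hdisj⟩, fun heq => (heq ▸ hcard ▸ hr).false, hξ⟩
  · rintro ⟨t, ⟨ht, hsub, hdisj⟩, hne, hξ⟩
    exact ⟨_, Finset.card_lt_card (hsub.ssubset_of_ne hne), t, ⟨⟨ht, rfl⟩, hdisj, hsub⟩, hξ⟩

namespace IsFineTiling

theorem isSection (hP : IsFineTiling a P) : IsSection (lift a) ∅ P where
  linearIndepOn t ht := (hP.nondegenerate t ht).linearIndepOn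
  subset x hx := by
    obtain ⟨t, -, hxt⟩ := mem_faceUnion.1 hx
    exact mem_cubeFace_compl.2 fun i =>
      ⟨(mem_cubeFace.1 hxt i).1, fun hi => absurd hi (Finset.notMem_empty i)⟩
  injOn x hx y hy hxy := by
    obtain ⟨t, ht, hxt⟩ := mem_faceUnion.1 hx
    obtain ⟨t', ht', hyt'⟩ := mem_faceUnion.1 hy
    have hmem : comb (lift a) x ∈ cell a t ∩ cell a t' := by
      rw [cell_eq_image (hP.disjoint t ht), cell_eq_image (hP.disjoint t' ht')]
      exact ⟨⟨x, hxt, rfl⟩, ⟨y, hyt', hxy.symm⟩⟩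
    obtain hempty | ⟨f, hf, hf', hinter⟩ := hP.inter t ht t' ht'
    · exact absurd hmem (hempty ▸ Set.notMem_empty _)
    · rw [hinter, cell_eq_image hf.2.1] at hmem
      obtain ⟨z, hz, hzx⟩ := hmem
      have hunique : ∀ s ∈ P, IsFace f s → ∀ w ∈ cubeFace s,
          comb (lift a) z = comb (lift a) w → z = w := fun s hs hfs w hw hzw =>
        eq_of_comb_eq (hP.nondegenerate s hs).linearIndepOn
          (fun i hi => eq_of_mem_cubeFace (hfs.cubeFace_subset hz) hw (Or.inr hi)) hzw
      exact (hunique t ht hf x hxt hzx).symm.trans (hunique t' ht' hf' y hyt' (hzx.trans hxy))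
  surjOn := by
    rw [← zonotope_eq_image, ← hP.cover]
    intro p hp
    obtain ⟨t, ht, hpt⟩ := Set.mem_iUnion₂.1 hp
    rw [cell_eq_image (hP.disjoint t ht)] at hpt
    obtain ⟨x, hx, hxp⟩ := hpt
    exact ⟨x, mem_faceUnion.2 ⟨t, ht, hx⟩, hxp⟩

theorem eq_of_isConvexWeight (hP : IsFineTiling a P) {t t' : Label n} (ht : t ∈ tilesOver P Q)
    (ht' : t' ∈ tilesOver P Q) {w w' : Fin n → ℝ}
    (hw : IsConvexWeight a (t.2 : Set (Fin n)) ξ w)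
    (hw' : IsConvexWeight a (t'.2 : Set (Fin n)) ξ w') : w = w' := by
  have hmem : ∀ s ∈ tilesOver P Q, ∀ u, IsConvexWeight a (s.2 : Set (Fin n)) ξ u →
      (1 / 2 : ℝ) • u ∈ faceUnion (deleteLabel Q '' P) := by
    rintro s ⟨hs, hsub, hdisj⟩ u hu
    rw [faceUnion_image_deleteLabel,
      ← zeroOn_raise hsub fun i hi => hu.eq_zero i (Finset.disjoint_right.1 hdisj hi)]
    exact ⟨_, mem_faceUnion.2 ⟨s, hs, hu.raise_mem_cubeFace⟩, rfl⟩
  refine smul_right_injective _ (one_half_pos (α := ℝ)).ne'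
    ((hP.isSection.delete Q).injOn (hmem t ht w hw) (hmem t' ht' w' hw') ?_)
  rw [map_smul, map_smul, hw.comb_lift, hw'.comb_lift]

theorem fst_eq_of_mem_interior (hP : IsFineTiling a P) {t t' : Label n}
    (ht : t ∈ tilesOver P Q) (ht' : t' ∈ tilesOver P Q) (hξ : ξ ∈ interior (simplex a t.2))
    (hξ' : ξ ∈ simplex a t'.2) : t.1 = t'.1 := by
  obtain ⟨w, hw⟩ := mem_simplex_iff.1 (interior_subset hξ)
  obtain ⟨w', hw'⟩ := mem_simplex_iff.1 hξ'
  obtain rfl := hP.eq_of_isConvexWeight ht ht' hw hw'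
  obtain ⟨ht, hsub, hdisj⟩ := ht
  obtain ⟨ht', hsub', -⟩ := ht'
  have hzero : ∀ i ∈ Q, w i = 0 := fun i hi =>
    hw.eq_zero i (Finset.disjoint_right.1 hdisj hi)
  have heq : raise t.1 w = raise t'.1 w := by
    refine hP.isSection.eq_of_comb_zeroOn_eq (Q := Q) (F := t.2)
      (mem_faceUnion.2 ⟨t, ht, hw.raise_mem_cubeFace⟩)
      (mem_faceUnion.2 ⟨t', ht', hw'.raise_mem_cubeFace⟩) ?_ (fun i hi => ?_) hdisj.symm ?_
    · rw [finrank_pt_prod, (hP.nondegenerate t ht).1]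
    · have hit := Finset.disjoint_right.1 (hP.disjoint t ht) hi
      refine ⟨?_, hw.raise_lt_one_iff.2 hit⟩
      simpa [raise, hit] using (hP.nondegenerate t ht).pos_of_mem_interior hξ hw i hi
    · rw [zeroOn_raise hsub hzero, zeroOn_raise hsub' hzero]
  ext i
  rw [← not_iff_not, ← hw.raise_lt_one_iff, heq, hw.raise_lt_one_iff]

theorem exists_mem_simplex_sdiff (hP : IsFineTiling a P) (hξ : ξ ∈ hullOutside a Q) :
    ∃ t ∈ P, t.1 ⊆ Q ∧ ξ ∈ simplex a (t.2 \ Q) := by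
  obtain ⟨w, hw⟩ := mem_convexHull_image_iff.1 hξ
  have hbox : (1 / 2 : ℝ) • w ∈ cubeFace (∅, Qᶜ) :=
    (hw.mono fun i hi => hw.eq_zero i (by simpa using hi)).half_smul_mem_cubeFace
  obtain ⟨y, hy, hyw⟩ := (hP.isSection.delete Q).surjOn ⟨_, hbox, rfl⟩
  obtain ⟨_, ⟨t, ht, rfl⟩, hyt⟩ := mem_faceUnion.1 hy
  rw [mem_cubeFace] at hyt
  have hcomb : comb (lift a) ((2 : ℝ) • y) = (ξ, 1) := by
    rw [map_smul, hyw, ← map_smul, smul_smul]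
    norm_num [hw.comb_lift]
  rw [comb_lift, Prod.mk.injEq] at hcomb
  have hweight : IsConvexWeight a Set.univ ξ ((2 : ℝ) • y) :=
    ⟨fun i => mul_nonneg zero_le_two (hyt i).1.1, by simp, hcomb.2, hcomb.1⟩
  have hsub : t.1 ⊆ Q := by
    intro i hi
    by_contra hiQ
    have hle := hweight.le_one i
    rw [Pi.smul_apply, (hyt i).2.1 (Finset.mem_sdiff.2 ⟨hi, hiQ⟩)] at hle
    norm_num at hle
  refine ⟨t, ht, hsub, mem_simplex_iff.2 ⟨_, hweight.mono fun i hi => ?_⟩⟩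
  rw [Pi.smul_apply, (hyt i).2.2 (fun h => (Finset.mem_sdiff.1 h).2 (hsub (Finset.mem_sdiff.1 h).1))
    hi, smul_zero]

theorem mem_tilesOver_fst (hP : IsFineTiling a P) {t : Label n} (ht : t ∈ P) :
    t ∈ tilesOver P t.1 :=
  ⟨ht, subset_rfl, (hP.disjoint t ht).symm⟩

theorem mem_linkRegion_iff (hP : IsFineTiling a P) :
    ξ ∈ linkRegion a P Q ↔ ∃ B, (Q, B) ∈ P ∧ ξ ∈ simplex a B := by
  rw [mem_linkRegion_iff_exists_tilesOver]
  constructor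
  · rintro ⟨t, ht, rfl, hξ⟩
    exact ⟨t.2, ht.1, hξ⟩
  · rintro ⟨B, hB, hξ⟩
    exact ⟨(Q, B), hP.mem_tilesOver_fst hB, rfl, hξ⟩

theorem linkRegion_eq_biUnion (hP : IsFineTiling a P) (Q : Finset (Fin n)) :
    linkRegion a P Q = ⋃ B ∈ links P Q, simplex a B := by
  ext ξ
  simp only [hP.mem_linkRegion_iff, links, Set.mem_iUnion₂, Set.mem_ofPred_eq, exists_prop]

theorem isTriangulation (hP : IsFineTiling a P) (Q : Finset (Fin n)) :
    IsTriangulation a (links P Q) (linkRegion a P Q) where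
  nondegenerate B hB := hP.nondegenerate _ hB
  cover := (hP.linkRegion_eq_biUnion Q).symm
  inter B hB B' hB' := by
    refine subset_antisymm ?_ (Set.subset_inter
      (convexHull_mono (Set.image_mono (by simp))) (convexHull_mono (Set.image_mono (by simp))))
    rintro ξ ⟨hξ, hξ'⟩
    obtain ⟨w, hw⟩ := mem_simplex_iff.1 hξ
    obtain ⟨w', hw'⟩ := mem_simplex_iff.1 hξ'
    obtain rfl := hP.eq_of_isConvexWeight (t := (Q, B)) (t' := (Q, B'))
      (hP.mem_tilesOver_fst hB) (hP.mem_tilesOver_fst hB') hw hw'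
    refine mem_simplex_iff.2 ⟨w, hw.mono fun i hi => ?_⟩
    by_cases hiB : i ∈ B
    · exact hw'.eq_zero i fun hiB' => hi (Finset.mem_inter.2 ⟨hiB, hiB'⟩)
    · exact hw.eq_zero i hiB

theorem isClosed_linkRegion (hP : IsFineTiling a P) (Q : Finset (Fin n)) :
    IsClosed (linkRegion a P Q) := by
  rw [hP.linkRegion_eq_biUnion]
  exact (Set.toFinite _).isClosed_biUnion fun B _ => isClosed_simplex a B

theorem linkRegion_nonempty_iff (hP : IsFineTiling a P) :
    (linkRegion a P Q).Nonempty ↔ ∃ B, (Q, B) ∈ P := by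
  simp only [Set.Nonempty, hP.mem_linkRegion_iff]
  constructor
  · rintro ⟨ξ, B, hB, -⟩
    exact ⟨B, hB⟩
  · rintro ⟨B, hB⟩
    obtain ⟨ξ, hξ⟩ := (hP.nondegenerate _ hB).interior_nonempty
    exact ⟨ξ, B, hB, interior_subset hξ⟩

theorem computedRegion_subset (hP : IsFineTiling a P) :
    computedRegion a P Q ⊆ linkRegion a P Q := by
  refine closure_minimal ?_ (hP.isClosed_linkRegion Q)
  set U := interior (hullOutside a Q \ ⋃ r ∈ Finset.range Q.card, region a P r Q)
  -- Outside the tiles over `Q`, only simplices of lower dimension are left.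
  have hsub : U \ linkRegion a P Q ⊆ ⋃ C ∈ {C : Finset (Fin n) | C.card ≤ d}, simplex a C := by
    rintro ξ ⟨hξU, hξlink⟩
    obtain ⟨hξhull, hξlower⟩ := interior_subset hξU
    obtain ⟨t, ht, hsub, hξt⟩ := hP.exists_mem_simplex_sdiff hξhull
    refine Set.mem_biUnion (x := t.2 \ Q) ?_ hξt
    by_contra hcard
    have hsdiff : t.2 \ Q = t.2 := Finset.eq_of_subset_of_card_le Finset.sdiff_subset
      ((hP.nondegenerate t ht).1.trans_le (Nat.lt_of_not_le hcard))
    have hover : t ∈ tilesOver P Q := ⟨ht, hsub, Finset.sdiff_eq_self_iff_disjoint.1 hsdiff⟩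
    rw [hsdiff] at hξt
    by_cases htQ : t.1 = Q
    · exact hξlink (mem_linkRegion_iff_exists_tilesOver.2 ⟨t, hover, htQ, hξt⟩)
    · exact hξlower (mem_biUnion_region_iff.2 ⟨t, hover, htQ, hξt⟩)
  have hempty := interior_biUnion_eq_empty (Set.toFinite {C : Finset (Fin n) | C.card ≤ d})
    (fun C _ => isClosed_simplex a C) fun C hC => interior_simplex_eq_empty hC
  rw [← Set.sdiff_eq_empty, ← Set.subset_empty_iff, ← hempty]
  exact interior_maximal hsub (isOpen_interior.sdiff (hP.isClosed_linkRegion Q))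

theorem subset_computedRegion (hP : IsFineTiling a P) :
    linkRegion a P Q ⊆ computedRegion a P Q := by
  intro ξ hξ
  obtain ⟨B, hB, hξB⟩ := hP.mem_linkRegion_iff.1 hξ
  rw [← (hP.nondegenerate _ hB).closure_interior] at hξB
  refine closure_mono (interior_maximal ?_ isOpen_interior) hξB
  refine fun η hη => ⟨?_, fun hlower => ?_⟩
  · exact convexHull_mono (Set.image_mono fun i hi => Finset.disjoint_right.1 (hP.disjoint _ hB) hi)
      (interior_subset hη)
  · obtain ⟨t, ht, hne, hηt⟩ := mem_biUnion_region_iff.1 hlower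
    exact hne (hP.fst_eq_of_mem_interior (hP.mem_tilesOver_fst hB) ht hη hηt).symm

theorem computedRegion_eq (hP : IsFineTiling a P) (Q : Finset (Fin n)) :
    computedRegion a P Q = linkRegion a P Q :=
  hP.computedRegion_subset.antisymm hP.subset_computedRegion

end IsFineTiling

end Tilings

theorem computedRegion_congr (a : Fin n → Pt d) {S S' : Set (Label n)} {Q : Finset (Fin n)}
    (h : ∀ r < Q.card, ofOrder S r = ofOrder S' r) :
    computedRegion a S Q = computedRegion a S' Q := by
  have hregion : ∀ r ∈ Finset.range Q.card, region a S r Q = region a S' r Q := fun r hr => by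
    rw [region, region, h r (Finset.mem_range.1 hr)]
  rw [computedRegion, computedRegion, Set.iUnion₂_congr hregion]

theorem newTiles_links (P : Set (Label n)) (k : ℕ) :
    newTiles (links P) (bottoms P k) = ofOrder P k :=
  Set.ext fun t => ⟨fun ⟨⟨hcard, _⟩, ht⟩ => ⟨ht, hcard⟩, fun ⟨ht, hcard⟩ => ⟨⟨hcard, t.2, ht⟩, ht⟩⟩

theorem setOf_card_lt_union_ofOrder (P : Set (Label n)) (k : ℕ) :
    {t ∈ P | t.1.card < k} ∪ ofOrder P k = {t ∈ P | t.1.card < k + 1} := by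
  ext t
  simp only [ofOrder, Set.mem_union, Set.mem_ofPred_eq, Nat.lt_succ_iff_lt_or_eq, and_or_left]

theorem pairwiseDisjoint_ofOrder (P : Set (Label n)) (s : Set ℕ) : s.PairwiseDisjoint (ofOrder P) :=
  fun _ _ _ _ hjk => Set.disjoint_left.2 fun _ hj hk => hjk (hj.2.symm.trans hk.2)

namespace IsFineTiling

variable {a : Fin n → Pt d} {P : Set (Label n)}

theorem exists_empty_mem (hP : IsFineTiling a P) : ∃ B, (∅, B) ∈ P := by
  obtain ⟨⟨_, B⟩, ht, rfl, -⟩ := hP.isSection.exists_mem_fst_eq_empty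
    (f := LinearMap.snd ℝ (Pt d) ℝ) fun _ => zero_lt_one
  exact ⟨B, ht⟩

theorem exists_mem_erase (hP : IsFineTiling a P) {Q B : Finset (Fin n)} (hQB : (Q, B) ∈ P)
    (hQ : Q.Nonempty) : ∃ b ∈ Q, ∃ B', (Q.erase b, B') ∈ P ∧ b ∈ B' :=
  hP.isSection.exists_mem_erase (f := LinearMap.snd ℝ (Pt d) ℝ) (fun _ => zero_lt_one) hQB
    (hP.disjoint _ hQB) ((hP.nondegenerate _ hQB).1.trans finrank_pt_prod.symm) hQ

theorem computedRegion_eq_of_card_le (hP : IsFineTiling a P) {k : ℕ} {Q : Finset (Fin n)}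
    (hQ : Q.card ≤ k) : computedRegion a {t ∈ P | t.1.card < k} Q = linkRegion a P Q := by
  rw [← hP.computedRegion_eq]
  refine computedRegion_congr a fun r hr => Set.ext fun t => ?_
  simp only [ofOrder, Set.mem_ofPred_eq]
  exact ⟨fun ⟨⟨ht, _⟩, hcard⟩ => ⟨ht, hcard⟩,
    fun ⟨ht, hcard⟩ => ⟨⟨ht, hcard.trans_lt (hr.trans_le hQ)⟩, hcard⟩⟩

theorem bottoms_zero (hP : IsFineTiling a P) : bottoms P 0 = {∅} := by
  ext I
  simp only [bottoms, Finset.card_eq_zero, Set.mem_ofPred_eq, Set.mem_singleton_iff,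
    and_iff_left_iff_imp]
  rintro rfl
  exact hP.exists_empty_mem

theorem card_insert_of_mem (hP : IsFineTiling a P) {k : ℕ} {t : Label n} (ht : t ∈ ofOrder P k)
    {b : Fin n} (hb : b ∈ t.2) : (insert b t.1).card = k + 1 := by
  rw [Finset.card_insert_of_notMem (Finset.disjoint_right.1 (hP.disjoint t ht.1) hb), ht.2]

theorem mem_bottoms_succ_iff (hP : IsFineTiling a P) {k : ℕ} {Q : Finset (Fin n)} :
    Q ∈ bottoms P (k + 1) ↔
      ∃ t ∈ ofOrder P k, ∃ b ∈ t.2, Q = insert b t.1 ∧ (linkRegion a P Q).Nonempty := by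
  constructor
  · rintro ⟨hcard, B, hB⟩
    obtain ⟨b, hbQ, B', hB', hb⟩ := hP.exists_mem_erase hB (Finset.card_pos.1 (by omega))
    refine ⟨_, ⟨hB', ?_⟩, b, hb, (Finset.insert_erase hbQ).symm,
      hP.linkRegion_nonempty_iff.2 ⟨B, hB⟩⟩
    rw [Finset.card_erase_of_mem hbQ, hcard, Nat.add_sub_cancel]
  · rintro ⟨t, ht, b, hb, rfl, hne⟩
    exact ⟨hP.card_insert_of_mem ht hb, hP.linkRegion_nonempty_iff.1 hne⟩

theorem state_eq (hP : IsFineTiling a P) (k : ℕ) :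
    state a (links P) k = (bottoms P k, {t ∈ P | t.1.card < k}) := by
  induction k with
  | zero => simp [state, hP.bottoms_zero]
  | succ k ih =>
    simp only [state, ih, newTiles_links, setOf_card_lt_union_ofOrder]
    refine Prod.ext (Set.ext fun Q => ?_) rfl
    rw [hP.mem_bottoms_succ_iff]
    refine exists_congr fun t => and_congr_right fun ht => exists_congr fun b =>
      and_congr_right fun hb => and_congr_right fun hQ => ?_
    rw [hP.computedRegion_eq_of_card_le (hQ ▸ (hP.card_insert_of_mem ht hb).le)]

theorem indexSets_links (hP : IsFineTiling a P) (k : ℕ) :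
    indexSets a (links P) k = bottoms P k := by
  rw [indexSets, hP.state_eq]

theorem tilesAt_links (hP : IsFineTiling a P) (k : ℕ) :
    tilesAt a (links P) k = ofOrder P k := by
  rw [tilesAt, hP.indexSets_links, newTiles_links]

theorem computedRegion_tilesBefore (hP : IsFineTiling a P) {k : ℕ} {I : Finset (Fin n)}
    (hI : I ∈ indexSets a (links P) k) :
    computedRegion a (tilesBefore a (links P) k) I = linkRegion a P I := by
  rw [hP.indexSets_links] at hI
  rw [tilesBefore, hP.state_eq, hP.computedRegion_eq_of_card_le hI.1.le]

theorem indexSets_succ_eq (hP : IsFineTiling a P) (k : ℕ) :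
    indexSets a (links P) (k + 1) = {Q | ∃ I B, (I, B) ∈ ofOrder P k ∧ ∃ b ∈ B, b ∉ I ∧
      Q = insert b I ∧ (linkRegion a P Q).Nonempty} := by
  ext Q
  rw [hP.indexSets_links, hP.mem_bottoms_succ_iff]
  constructor
  · rintro ⟨⟨I, B⟩, ht, b, hb, hQ⟩
    exact ⟨I, B, ht, b, hb, Finset.disjoint_right.1 (hP.disjoint _ ht.1) hb, hQ⟩
  · rintro ⟨I, B, ht, b, hb, -, hQ⟩
    exact ⟨(I, B), ht, b, hb, hQ⟩

theorem order_add_le (hP : IsFineTiling a P) {t : Label n} (ht : t ∈ P) :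
    t.1.card + d + 1 ≤ n := by
  have hle := Finset.card_le_univ (t.1 ∪ t.2)
  rwa [Finset.card_union_of_disjoint (hP.disjoint t ht), (hP.nondegenerate t ht).1,
    Fintype.card_fin, ← add_assoc] at hle

theorem indexSets_sub_eq_empty (hP : IsFineTiling a P) : indexSets a (links P) (n - d) = ∅ := by
  rw [hP.indexSets_links]
  refine Set.eq_empty_of_forall_notMem fun Q ⟨hcard, B, hB⟩ => ?_
  have hle : Q.card + d + 1 ≤ n := hP.order_add_le hB
  omega

theorem eq_biUnion_ofOrder (hP : IsFineTiling a P) :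
    P = ⋃ k ∈ {k : ℕ | k + d + 1 ≤ n}, ofOrder P k := by
  refine subset_antisymm (fun t ht => ?_) (Set.iUnion₂_subset fun _ _ _ ht => ht.1)
  exact Set.mem_iUnion₂.2 ⟨t.1.card, hP.order_add_le ht, ht, rfl⟩

end IsFineTiling

end ZonotopalTiling

end

open ZonotopalTiling in
theorem theorem4 (d n : ℕ) (a : Fin n → Pt d) (ha : affineSpan ℝ (Set.range a) = ⊤)
    (P : Set (Label n)) (hP : IsFineTiling a P) :
    ∃ T : Finset (Fin n) → Set (Finset (Fin n)),
      -- a triangulation is chosen for the link region of every index set that occurs in `P`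
      (∀ I : Finset (Fin n), (∃ B, (I, B) ∈ P) → IsTriangulation a (T I) (linkRegion a P I)) ∧
      -- the construction finds `P^(k)` at stage `k`
      (∀ k : ℕ, k + d + 1 ≤ n →
        (∀ I ∈ indexSets a T k,
          computedRegion a (tilesBefore a T k) I = linkRegion a P I ∧
          IsTriangulation a (T I) (computedRegion a (tilesBefore a T k) I)) ∧
        ofOrder P k = tilesAt a T k ∧
        indexSets a T (k + 1) = {Q | ∃ I B, (I, B) ∈ ofOrder P k ∧ ∃ b ∈ B, b ∉ I ∧
          Q = insert b I ∧ (linkRegion a P Q).Nonempty}) ∧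
      -- it stops after stage `n - d - 1` and has then found all of `P`
      indexSets a T (n - d) = ∅ ∧
      P = ⋃ k ∈ {k : ℕ | k + d + 1 ≤ n}, tilesAt a T k ∧
      {k : ℕ | k + d + 1 ≤ n}.PairwiseDisjoint (tilesAt a T) ∧
      -- it also yields the associated spline spaces of all orders
      (∀ β : Finset (Fin n) → Finset (Fin n), IsSelection a β → ∀ k : ℕ, k + d + 1 ≤ n →
        splineSpace a β k (ofOrder P k) = splineSpace a β k (tilesAt a T k)) := by
  have htiles := hP.tilesAt_links
  refine ⟨links P, fun I _ => hP.isTriangulation I,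
    fun k _ => ⟨fun I hI => ?_, (htiles k).symm, hP.indexSets_succ_eq k⟩,
    hP.indexSets_sub_eq_empty, ?_, ?_, fun β _ k _ => by rw [htiles]⟩
  · have hregion := hP.computedRegion_tilesBefore hI
    exact ⟨hregion, hregion ▸ hP.isTriangulation I⟩
  · simpa only [htiles] using hP.eq_biUnion_ofOrder
  · simpa only [funext htiles] using pairwiseDisjoint_ofOrder P _
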